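/- Let $Q$ be a smooth ($C^\infty$) finite-dimensional manifold without boundary, Hausdorff and second countable, with projections $\tau_Q : TQ\to Q$ and $\pi_Q : T^*Q\to Q$. For a manifold $M$ let $\theta_M$ be the Liouville $1$-form on $T^*M$, $\theta_M(\alpha)(X)=\alpha(T\pi_M X)$, and $\omega_M=-d\theta_M$. Let $U\subseteq TQ$ be an open neighbourhood of the zero section and let $R_d=(R^1,R^2):U\to Q\times Q$ be a discretization map on $Q$, i.e. a smooth map such that for every $x\in Q$: (1) $R_d(0_x)=(x,x)$; (2) $T_{0_x}R^2_x-T_{0_x}R^1_x=\mathrm{Id}_{T_xQ}$, where $R^a_x$ is the restriction of $R^a$ to $U\cap T_xQ$ and $T_{0_x}T_xQ\simeq T_xQ$. Consider: Tulczyjew's map $\alpha_Q:TT^*Q\to T^*TQ$, in induced coordinates $(q,p,\dot q,\dot p)\mapsto(q,\dot q,\dot p,p)$; the map $\widehat{R_d}$ with $\widehat{R_d}(\alpha_\xi)=\alpha_\xi\circ(T_\xi R_d)^{-1}\in T^*_{R_d(\xi)}(Q\times Q)$ for $\alpha_\xi\in T^*_\xi TQ$ (defined where $T_\xi R_d$ is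 invertible); the bijection $\Phi:T^*Q\times T^*Q\to T^*(Q\times Q)$, $(q_0,p_0;q_1,p_1)\mapsto(q_0,q_1,-p_0,p_1)$; and the cotangent lift $R_d^{T^*}=\Phi^{-1}\circ\widehat{R_d}\circ\alpha_Q$. On $TT^*Q$ take the $2$-form $d_T\omega_Q$, where $d_T=i_Td+d\,i_T$ and $(i_T\eta)_v(X_1,\dots,X_k)=\eta(v,T\tau X_1,\dots,T\tau X_k)$ for a $(k+1)$-form $\eta$ on a manifold $M$, $v\in TM$, $X_i\in T_vTM$, and $\tau:TM\to M$ the projection (in coordinates, $d_T\omega_Q=dq\wedge d\dot p+d\dot q\wedge dp$). On $T^*Q\times T^*Q$ take $\Omega_{12}=\mathrm{pr}_2^*\omega_Q-\mathrm{pr}_1^*\omega_Q$. Then $d_T\omega_Q$ and $\Omega_{12}$ are symplectic forms. There is an open neighbourhood $V\subseteq U$ of the zero section such that $R_d$ restricts to a diffeomorphism from $V$ onto an open subset of $Q\times Q$. And for every open $V\subseteq U$ such that $R_d$ restricts to a diffeomorphism from $V$ onto an open set $R_d(V)$, the cotangent lift $R_d^{T^*}$ restricts to a symplectomorphism from the open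 set $(T\pi_Q)^{-1}(V)\subseteq TT^*Q$ with the form $d_T\omega_Q$ onto the open set $(\pi_Q\times\pi_Q)^{-1}(R_d(V))\subseteq T^*Q\times T^*Q$ with the form $\Omega_{12}$: it is a smooth diffeomorphism between these sets and $(R_d^{T^*})^*\Omega_{12}=d_T\omega_Q$ on $(T\pi_Q)^{-1}(V)$. In particular, if $U=TQ$ and $R_d:TQ\to Q\times Q$ is a diffeomorphism, then $R_d^{T^*}$ is a symplectomorphism from $(TT^*Q,d_T\omega_Q)$ onto $(T^*Q\times T^*Q,\Omega_{12})$. -/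

import Mathlib

open Set Bundle
open scoped Manifold ContDiff Topology

noncomputable section

/-! ### Differential forms on a manifold -/

section Forms

variable {E : Type*} [NormedAddCommGroup E] [NormedSpace ℝ E]
  {H : Type*} [TopologicalSpace H] (I : ModelWithCorners ℝ E H)
  (M : Type*) [TopologicalSpace M] [ChartedSpace H M]
  {E' : Type*} [NormedAddCommGroup E'] [NormedSpace ℝ E']
  {H' : Type*} [TopologicalSpace H'] (J : ModelWithCorners ℝ E' H')
  {N : Type*} [TopologicalSpace N] [ChartedSpace H' N]

/-- Real-valued differential `k`-forms on `M` (no regularity imposed). -/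
abbrev DiffForm (k : ℕ) : Type _ := (x : M) → TangentSpace I x [⋀^Fin k]→L[ℝ] ℝ

variable {M}

/-- The pull-back `f^* η` of a form along a map. -/
def DiffForm.pullback {k : ℕ} (f : M → N) (η : DiffForm J N k) : DiffForm I M k :=
  fun x => (η (f x)).compContinuousLinearMap (mfderiv I J f x)

/-- The expression of a form in the preferred chart around `x₀`: the pull-back of `η` under the
inverse chart, as a form on the model vector space. -/
def DiffForm.inChart {k : ℕ} (η : DiffForm I M k) (x₀ : M) : E → E [⋀^Fin k]→L[ℝ] ℝ :=
  fun y => (η ((extChartAt I x₀).symm y)).compContinuousLinearMap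
    (mfderivWithin 𝓘(ℝ, E) I (extChartAt I x₀).symm (range I) y)

/-- The exterior derivative of a form on a manifold, computed at `x` in the chart around `x`. -/
def DiffForm.d {k : ℕ} (η : DiffForm I M k) : DiffForm I M (k + 1) :=
  fun x => ContinuousAlternatingMap.compContinuousLinearMap
    (extDerivWithin (DiffForm.inChart I η x) (range I) (extChartAt I x x))
    (mfderiv I 𝓘(ℝ, E) (extChartAt I x) x)

/-- A form is smooth if its expressions in charts have smooth coefficients. -/
def DiffForm.IsSmooth {k : ℕ} (η : DiffForm I M k) : Prop :=
  ∀ x₀ : M, ContDiffOn ℝ ∞ (DiffForm.inChart I η x₀) (extChartAt I x₀).target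

/-- A symplectic form: a smooth, closed, nondegenerate 2-form. -/
structure DiffForm.IsSymplectic (η : DiffForm I M 2) : Prop where
  smooth : DiffForm.IsSmooth I η
  closed : DiffForm.d I η = 0
  nondegenerate : ∀ (x : M) (v : TangentSpace I x),
    (∀ w : TangentSpace I x, η x ![v, w] = 0) → v = 0

/-- `i_T η`, the `k`-form on `TM` attached to a `(k+1)`-form `η` on `M`:
`(i_T η)_v (X₁, …, X_k) = η (v, Tτ X₁, …, Tτ X_k)`, with `τ : TM → M` the projection. -/
def DiffForm.iT [IsManifold I ∞ M] {k : ℕ} (η : DiffForm I M (k + 1)) :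
    DiffForm I.tangent (TangentBundle I M) k :=
  fun v => ContinuousAlternatingMap.compContinuousLinearMap
    (ContinuousAlternatingMap.curryLeft (E := E) (η v.proj) v.snd)
    (mfderiv I.tangent I (TotalSpace.proj : TangentBundle I M → M) v)

/-- Tulczyjew's derivation `d_T = i_T d + d i_T`, from forms on `M` to forms on `TM`. -/
def DiffForm.dT [IsManifold I ∞ M] {k : ℕ} (η : DiffForm I M (k + 1)) :
    DiffForm I.tangent (TangentBundle I M) (k + 1) :=
  DiffForm.iT I (DiffForm.d I η) + DiffForm.d I.tangent (DiffForm.iT I η)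

/-- `f` restricts to a smooth diffeomorphism from the open set `A` onto the open set `B`. -/
def IsDiffeoOn (f : M → N) (A : Set M) (B : Set N) : Prop :=
  IsOpen A ∧ IsOpen B ∧ BijOn f A B ∧ ContMDiffOn I J ∞ f A ∧
    ∃ g : N → M, LeftInvOn g f A ∧ ContMDiffOn J I ∞ g B

/-- `f` restricts to a diffeomorphism from the open set `A` onto the open set `B` and
`f^* η₂ = η₁` on `A`. -/
def IsSymplectoOn (η₁ : DiffForm I M 2) (η₂ : DiffForm J N 2) (f : M → N)
    (A : Set M) (B : Set N) : Prop :=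
  IsDiffeoOn I J f A B ∧ ∀ x ∈ A, DiffForm.pullback I J f η₂ x = η₁ x

end Forms

/-! ### The cotangent bundle and its canonical symplectic form -/

section Cotangent

variable {E : Type*} [NormedAddCommGroup E] [NormedSpace ℝ E]
  {H : Type*} [TopologicalSpace H] (I : ModelWithCorners ℝ E H)
  (M : Type*) [TopologicalSpace M] [ChartedSpace H M]
  {E' : Type*} [NormedAddCommGroup E'] [NormedSpace ℝ E']
  {H' : Type*} [TopologicalSpace H'] (J : ModelWithCorners ℝ E' H')
  {N : Type*} [TopologicalSpace N] [ChartedSpace H' N]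

/-- The cotangent bundle `T^*M`, with the topology and smooth structure that Mathlib puts on the
bundle of continuous linear maps from the tangent bundle to the trivial line bundle. -/
abbrev CotangentBundle : Type _ :=
  TotalSpace (E →L[ℝ] ℝ) (fun x : M => TangentSpace I x →L[ℝ] Bundle.Trivial M ℝ x)

/-- The model of the manifold `T^*M`. -/
abbrev ModelWithCorners.cotangent : ModelWithCorners ℝ (E × (E →L[ℝ] ℝ)) (ModelProd H (E →L[ℝ] ℝ)) :=
  I.prod 𝓘(ℝ, E →L[ℝ] ℝ)

variable {M}

/-- The canonical projection `π_M : T^*M → M`. -/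
abbrev cotangentProj : CotangentBundle I M → M := TotalSpace.proj

variable (M) in
/-- The Liouville 1-form: `θ_M(α)(X) = α (Tπ_M X)`. -/
def liouvilleForm [IsManifold I ∞ M] : DiffForm I.cotangent (CotangentBundle I M) 1 :=
  fun α => ContinuousAlternatingMap.ofSubsingleton ℝ (TangentSpace I.cotangent α) ℝ (0 : Fin 1)
    (ContinuousLinearMap.comp (α.snd : TangentSpace I α.proj →L[ℝ] ℝ)
      (mfderiv I.cotangent I (cotangentProj I (M := M)) α))

variable (M) in
/-- The canonical 2-form `ω_M = -dθ_M` on `T^*M`. -/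
def canonicalForm [IsManifold I ∞ M] : DiffForm I.cotangent (CotangentBundle I M) 2 :=
  -DiffForm.d I.cotangent (liouvilleForm I M)

variable (M) in
/-- The 2-form `Ω₁₂ = pr₂^* ω_M - pr₁^* ω_M` on `T^*M × T^*M`. -/
def omega12 [IsManifold I ∞ M] :
    DiffForm (I.cotangent.prod I.cotangent) (CotangentBundle I M × CotangentBundle I M) 2 :=
  DiffForm.pullback (I.cotangent.prod I.cotangent) I.cotangent Prod.snd (canonicalForm I M)
    - DiffForm.pullback (I.cotangent.prod I.cotangent) I.cotangent Prod.fst (canonicalForm I M)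

/-- `\hat F : T^*M → T^*N`, `\hat F (α_x) = α_x ∘ (T_x F)⁻¹ ∈ T^*_{F x} N`, the cotangent lift of
`F⁻¹`. It is meaningful at the points where `T_x F` is invertible; elsewhere
`ContinuousLinearMap.inverse` is `0` by convention. -/
def cotangentHat (F : M → N) (α : CotangentBundle I M) : CotangentBundle J N :=
  ⟨F α.proj, ContinuousLinearMap.comp (α.snd : TangentSpace I α.proj →L[ℝ] ℝ)
    (ContinuousLinearMap.inverse (mfderiv I J F α.proj))⟩

/-- `Φ : T^*M × T^*M → T^*(M × M)`, `Φ(q₀, p₀; q₁, p₁) = (q₀, q₁, -p₀, p₁)`. -/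
def cotangentPhi :
    CotangentBundle I M × CotangentBundle I M ≃ CotangentBundle (I.prod I) (M × M) where
  toFun a := ⟨(a.1.proj, a.2.proj),
    -(ContinuousLinearMap.comp (a.1.snd : E →L[ℝ] ℝ) (ContinuousLinearMap.fst ℝ E E))
      + ContinuousLinearMap.comp (a.2.snd : E →L[ℝ] ℝ) (ContinuousLinearMap.snd ℝ E E)⟩
  invFun γ :=
    (⟨γ.proj.1, -ContinuousLinearMap.comp (γ.snd : E × E →L[ℝ] ℝ)
        (ContinuousLinearMap.inl ℝ E E)⟩,
      ⟨γ.proj.2, ContinuousLinearMap.comp (γ.snd : E × E →L[ℝ] ℝ)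
        (ContinuousLinearMap.inr ℝ E E)⟩)
  left_inv := by
    rintro ⟨⟨x, a⟩, ⟨y, b⟩⟩
    have h (a b : E →L[ℝ] ℝ) : -((-a.comp (ContinuousLinearMap.fst ℝ E E) +
        b.comp (ContinuousLinearMap.snd ℝ E E)).comp (ContinuousLinearMap.inl ℝ E E)) = a := by
      ext; simp
    have h' (a b : E →L[ℝ] ℝ) : (-a.comp (ContinuousLinearMap.fst ℝ E E) +
        b.comp (ContinuousLinearMap.snd ℝ E E)).comp (ContinuousLinearMap.inr ℝ E E) = b := by
      ext; simp
    exact Prod.ext (congrArg (TotalSpace.mk x) (h a b)) (congrArg (TotalSpace.mk y) (h' a b))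
  right_inv := by
    rintro ⟨⟨x, y⟩, c⟩
    have h (c : E × E →L[ℝ] ℝ) : -(-c.comp (ContinuousLinearMap.inl ℝ E E)).comp
        (ContinuousLinearMap.fst ℝ E E) + (c.comp (ContinuousLinearMap.inr ℝ E E)).comp
        (ContinuousLinearMap.snd ℝ E E) = c := by
      ext u
      · simp; exact map_zero c
      · simp; exact map_zero c
    exact congrArg (TotalSpace.mk (x, y)) (h c)

/-- Tulczyjew's map `α_M : T(T^*M) → T^*(TM)`, `(q, p, q̇, ṗ) ↦ (q, q̇, ṗ, p)`.

A vector `v` tangent to `T^*M` at `(q, p)` is stored by Mathlib as the pair `(q̇, ṗ)` of its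
coordinates in the chart of `T^*M` induced by the preferred chart of `M` around `q`; likewise a
vector tangent to `TM` at `(q, q̇)` is stored as the pair `(δq, δv)` of its coordinates in the chart
of `TM` induced by that same chart of `M`. The covector with coordinates `(ṗ, p)` is
`(δq, δv) ↦ ṗ(δq) + p(δv)`. -/
def tulczyjewAlpha [IsManifold I ∞ M] (v : TangentBundle I.cotangent (CotangentBundle I M)) :
    CotangentBundle I.tangent (TangentBundle I M) :=
  ⟨⟨v.proj.proj, (v.snd : E × (E →L[ℝ] ℝ)).1⟩,
    ContinuousLinearMap.comp (v.snd : E × (E →L[ℝ] ℝ)).2 (ContinuousLinearMap.fst ℝ E E)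
      + ContinuousLinearMap.comp (v.proj.snd : E →L[ℝ] ℝ) (ContinuousLinearMap.snd ℝ E E)⟩

end Cotangent

/-! ### Discretization maps and their cotangent lifts -/

section Discretization

variable {E : Type*} [NormedAddCommGroup E] [NormedSpace ℝ E]
  {H : Type*} [TopologicalSpace H] (I : ModelWithCorners ℝ E H)
  {Q : Type*} [TopologicalSpace Q] [ChartedSpace H Q] [IsManifold I ∞ Q]

/-- The derivative `T_{0_x} F_x : T_{0_x} T_x Q ≃ T_x Q → T_{F(0_x)} Q` of the restriction `F_x` of `F` to
the fibre `T_x Q`; Mathlib represents all these tangent spaces by the model space `E`. -/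
def fiberDeriv (F : TangentBundle I Q → Q) (x : Q) : E →L[ℝ] E :=
  mfderiv 𝓘(ℝ, E) I (fun v : E => F ⟨x, v⟩) (0 : E)

/-- `R` (whose values outside `U` are irrelevant) is a discretization map `U ⊆ TQ → Q × Q`.
In `rigid`, both derivatives take values in `T_x Q` by `map_zero`. -/
structure IsDiscretizationMap (U : Set (TangentBundle I Q)) (R : TangentBundle I Q → Q × Q) :
    Prop where
  isOpen : IsOpen U
  zero_mem : ∀ x : Q, (⟨x, 0⟩ : TangentBundle I Q) ∈ U
  smooth : ContMDiffOn I.tangent (I.prod I) ∞ R U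
  map_zero : ∀ x : Q, R ⟨x, 0⟩ = (x, x)
  rigid : ∀ x : Q, fiberDeriv I (fun ξ => (R ξ).2) x - fiberDeriv I (fun ξ => (R ξ).1) x
    = ContinuousLinearMap.id ℝ E

/-- The cotangent lift `R^{T^*} = Φ⁻¹ ∘ \hat R ∘ α_Q : T(T^*Q) → T^*Q × T^*Q`. -/
def cotangentLift (R : TangentBundle I Q → Q × Q) :
    TangentBundle I.cotangent (CotangentBundle I Q) → CotangentBundle I Q × CotangentBundle I Q :=
  (cotangentPhi I).symm ∘ cotangentHat I.tangent (I.prod I) R ∘ tulczyjewAlpha I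

end Discretization

end

/-!
`α_Q` and `Φ` are linear in induced charts, where `ω_Q`, `d_T ω_Q` and `Ω₁₂` have the same constant
coefficients in every chart, so that the claims about `α_Q`, about `Φ` and about nondegeneracy
are linear algebra. A diffeomorphism `R` lifts to `\hat R`, which preserves the Liouville form
because `T\hat R` covers `T R`, and hence preserves its exterior derivative. The cotangent lift is
the composite of these three symplectomorphisms.

At `0_x` a discretization map has the derivative `(u, v) ↦ (u + A v, u + B v)` with `B - A = id`,
whose inverse is `(a, b) ↦ (a - A (b - a), b - a)`. So it is a local diffeomorphism along the zero
section; since its values at the zero section determine the base point, it is moreover injective on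
a neighbourhood of the whole section, as a comparison of radii in a metric on `TQ` shows.
-/

noncomputable section

section Derivative

variable {E : Type*} [NormedAddCommGroup E] [NormedSpace ℝ E]
  {H : Type*} [TopologicalSpace H] (I : ModelWithCorners ℝ E H)
  {M : Type*} [TopologicalSpace M] [ChartedSpace H M]
  {E' : Type*} [NormedAddCommGroup E'] [NormedSpace ℝ E']
  {H' : Type*} [TopologicalSpace H'] (J : ModelWithCorners ℝ E' H')
  {N : Type*} [TopologicalSpace N] [ChartedSpace H' N]
  {E'' : Type*} [NormedAddCommGroup E''] [NormedSpace ℝ E'']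
  {H'' : Type*} [TopologicalSpace H''] (K : ModelWithCorners ℝ E'' H'')
  {P : Type*} [TopologicalSpace P] [ChartedSpace H'' P]

/-- The derivative `mfderiv I J f x`, read as a map between the model vector spaces. All tangent
spaces at points of `M` become the same type `E`, so that derivatives at points which are only
propositionally equal can be composed and compared. -/
def tderiv (f : M → N) (x : M) : E →L[ℝ] E' := mfderiv I J f x

variable {I J K}

theorem tderiv_comp {g : N → P} {f : M → N} (x : M) (hg : MDifferentiableAt J K g (f x))
    (hf : MDifferentiableAt I J f x) :
    tderiv I K (g ∘ f) x = tderiv J K g (f x) ∘L tderiv I J f x :=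
  mfderiv_comp x hg hf

theorem tderiv_comp_of_eq {g : N → P} {f : M → N} {x : M} {y : N}
    (hg : MDifferentiableAt J K g y) (hf : MDifferentiableAt I J f x) (hy : f x = y) :
    tderiv I K (g ∘ f) x = tderiv J K g y ∘L tderiv I J f x := by
  subst hy
  exact tderiv_comp x hg hf

theorem tderiv_congr {f g : M → N} {x : M} (h : f =ᶠ[𝓝 x] g) :
    tderiv I J f x = tderiv I J g x :=
  h.mfderiv_eq

theorem tderiv_id (x : M) : tderiv I I (id : M → M) x = ContinuousLinearMap.id ℝ E :=
  mfderiv_id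

theorem tderiv_eq_fderiv (f : E → E') (x : E) : tderiv 𝓘(ℝ, E) 𝓘(ℝ, E') f x = fderiv ℝ f x :=
  mfderiv_eq_fderiv

theorem tderiv_prodMk {f : M → N} {g : M → P} {x : M} (hf : MDifferentiableAt I J f x)
    (hg : MDifferentiableAt I K g x) :
    tderiv I (J.prod K) (fun y => (f y, g y)) x = (tderiv I J f x).prod (tderiv I K g x) :=
  (hf.hasMFDerivAt.prodMk hg.hasMFDerivAt).mfderiv

theorem eventually_mdifferentiableAt {f : M → N} {x : M} [IsManifold I 1 M] [IsManifold J 1 N]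
    (hf : ContMDiffAt I J ∞ f x) : ∀ᶠ y in 𝓝 x, MDifferentiableAt I J f y := by
  have h1 : ContMDiffAt I J 1 f x := hf.of_le (by norm_cast)
  filter_upwards [(contMDiffAt_iff_contMDiffAt_nhds (by simp)).1 h1] with y hy
  exact hy.mdifferentiableAt one_ne_zero

theorem tendsto_extChartAt_symm (x : M) :
    Filter.Tendsto (extChartAt I x).symm (𝓝 (extChartAt I x x)) (𝓝 x) := by
  have h : ContinuousAt (extChartAt I x).symm (extChartAt I x x) := continuousAt_extChartAt_symm x
  rwa [ContinuousAt, extChartAt_to_inv] at h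

theorem contDiffAt_writtenInExtChartAt [I.Boundaryless] {f : M → N} {x : M}
    (hf : ContMDiffAt I J ∞ f x) :
    ContDiffAt ℝ ∞ (writtenInExtChartAt I J x f) (extChartAt I x x) := by
  rw [← contDiffWithinAt_univ, ← I.range_eq_univ]
  exact (contMDiffAt_iff.1 hf).2

theorem contMDiffAt_extChartAt_symm [I.Boundaryless] {n : WithTop ℕ∞} [IsManifold I n M] {x : M}
    {y : E} (hy : y ∈ (extChartAt I x).target) :
    ContMDiffAt 𝓘(ℝ, E) I n (extChartAt I x).symm y :=
  (contMDiffOn_extChartAt_symm x).contMDiffAt (extChartAt_target_mem_nhds' hy)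

section Charts

variable [IsManifold I 1 M]

theorem tderiv_extChartAt_self (x : M) :
    tderiv I 𝓘(ℝ, E) (extChartAt I x) x = ContinuousLinearMap.id ℝ E :=
  mfderiv_extChartAt_self

theorem mdifferentiableAt_extChartAt_of_mem_source {x y : M} (hy : y ∈ (extChartAt I x).source) :
    MDifferentiableAt I 𝓘(ℝ, E) (extChartAt I x) y :=
  mdifferentiableAt_extChartAt (by rwa [← extChartAt_source I])

variable [I.Boundaryless]

theorem mdifferentiableAt_extChartAt_symm {x : M} {y : E} (hy : y ∈ (extChartAt I x).target) :
    MDifferentiableAt 𝓘(ℝ, E) I (extChartAt I x).symm y := by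
  rw [← mdifferentiableWithinAt_univ, ← I.range_eq_univ]
  exact mdifferentiableWithinAt_extChartAt_symm hy

theorem tderiv_extChartAt_symm_comp {x y : M} (hy : y ∈ (extChartAt I x).source) :
    tderiv 𝓘(ℝ, E) I (extChartAt I x).symm (extChartAt I x y) ∘L
      tderiv I 𝓘(ℝ, E) (extChartAt I x) y = ContinuousLinearMap.id ℝ E := by
  have h := mfderivWithin_extChartAt_symm_comp_mfderiv_extChartAt' (I := I) hy
  rwa [I.range_eq_univ, mfderivWithin_univ] at h

theorem tderiv_extChartAt_comp {x y : M} (hy : y ∈ (extChartAt I x).source) :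
    tderiv I 𝓘(ℝ, E) (extChartAt I x) y ∘L
      tderiv 𝓘(ℝ, E) I (extChartAt I x).symm (extChartAt I x y) = ContinuousLinearMap.id ℝ E := by
  have h := mfderiv_extChartAt_comp_mfderivWithin_extChartAt_symm' (I := I) hy
  rwa [I.range_eq_univ, mfderivWithin_univ] at h

theorem tderiv_extChartAt_symm_self (x : M) :
    tderiv 𝓘(ℝ, E) I (extChartAt I x).symm (extChartAt I x x) = ContinuousLinearMap.id ℝ E := by
  have h := tderiv_extChartAt_symm_comp (mem_extChartAt_source (I := I) x)
  rwa [tderiv_extChartAt_self, ContinuousLinearMap.comp_id] at h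

theorem fderiv_writtenInExtChartAt [IsManifold J 1 N] {f : M → N} {x y : M}
    (hy : y ∈ (extChartAt I x).source) (hfy : f y ∈ (extChartAt J (f x)).source)
    (hf : MDifferentiableAt I J f y) :
    fderiv ℝ (writtenInExtChartAt I J x f) (extChartAt I x y) =
      tderiv J 𝓘(ℝ, E') (extChartAt J (f x)) (f y) ∘L
        tderiv I J f y ∘L tderiv 𝓘(ℝ, E) I (extChartAt I x).symm (extChartAt I x y) := by
  have hφ := mdifferentiableAt_extChartAt_symm ((extChartAt I x).map_source hy)
  have hψ := mdifferentiableAt_extChartAt_of_mem_source hfy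
  have hl := (extChartAt I x).left_inv hy
  rw [← tderiv_eq_fderiv, ← tderiv_comp_of_eq hf hφ hl]
  exact tderiv_comp_of_eq hψ ((hl.symm ▸ hf : MDifferentiableAt I J f _).comp _ hφ)
    (congrArg f hl)

theorem fderiv_writtenInExtChartAt_self [IsManifold J 1 N] {f : M → N} {x : M}
    (hf : MDifferentiableAt I J f x) :
    fderiv ℝ (writtenInExtChartAt I J x f) (extChartAt I x x) = tderiv I J f x := by
  rw [fderiv_writtenInExtChartAt (mem_extChartAt_source x) (mem_extChartAt_source (f x)) hf,
    tderiv_extChartAt_self, tderiv_extChartAt_symm_self, ContinuousLinearMap.comp_id,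
    ContinuousLinearMap.id_comp]

end Charts

end Derivative

section LinearInCharts

variable {E : Type*} [NormedAddCommGroup E] [NormedSpace ℝ E]
  {H : Type*} [TopologicalSpace H] (I : ModelWithCorners ℝ E H)
  {M : Type*} [TopologicalSpace M] [ChartedSpace H M]
  {E' : Type*} [NormedAddCommGroup E'] [NormedSpace ℝ E']
  {H' : Type*} [TopologicalSpace H'] (J : ModelWithCorners ℝ E' H')
  {N : Type*} [TopologicalSpace N] [ChartedSpace H' N]

/-- In all the preferred charts at once (around any `x₀` and around `f x₀`), the map `f` reads as
the same continuous linear map `L`. This is the case of the maps between tangent and cotangent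
bundles which are given by universal formulas in induced coordinates. -/
def IsLinearInCharts (f : M → N) (L : E →L[ℝ] E') : Prop :=
  ∀ x₀ : M, ∀ x ∈ (extChartAt I x₀).source, f x ∈ (extChartAt J (f x₀)).source ∧
    extChartAt J (f x₀) (f x) = L (extChartAt I x₀ x)

namespace IsLinearInCharts

theorem fst : IsLinearInCharts (I.prod J) I (Prod.fst : M × N → M)
    (ContinuousLinearMap.fst ℝ E E') := by
  intro z₀ z hz
  rw [extChartAt_prod, PartialEquiv.prod_source, mem_prod] at hz
  exact ⟨hz.1, by rw [extChartAt_prod]; rfl⟩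

theorem snd : IsLinearInCharts (I.prod J) J (Prod.snd : M × N → N)
    (ContinuousLinearMap.snd ℝ E E') := by
  intro z₀ z hz
  rw [extChartAt_prod, PartialEquiv.prod_source, mem_prod] at hz
  exact ⟨hz.2, by rw [extChartAt_prod]; rfl⟩

variable {I J} {f : M → N} {L : E →L[ℝ] E'}

theorem eventuallyEq (hf : IsLinearInCharts I J f L) {x₀ x : M}
    (hx : x ∈ (extChartAt I x₀).source) :
    extChartAt J (f x₀) ∘ f =ᶠ[𝓝 x] L ∘ extChartAt I x₀ := by
  filter_upwards [extChartAt_source_mem_nhds' hx] with y hy using (hf x₀ y hy).2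

variable [IsManifold J ∞ N] [J.Boundaryless]

theorem contMDiff (hf : IsLinearInCharts I J f L) : ContMDiff I J ∞ f := by
  intro x
  have hφ : ContMDiffAt I 𝓘(ℝ, E) ∞ (extChartAt I x) x := contMDiffAt_extChartAt
  have hψ : ContMDiffAt 𝓘(ℝ, E') J ∞ (extChartAt J (f x)).symm (L (extChartAt I x x)) := by
    rw [← (hf x x (mem_extChartAt_source (I := I) x)).2]
    exact contMDiffAt_extChartAt_symm (mem_extChartAt_target (f x))
  refine (hψ.comp x (L.contDiff.contMDiff.contMDiffAt.comp x hφ)).congr_of_eventuallyEq ?_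
  filter_upwards [extChartAt_source_mem_nhds (I := I) x] with y hy
  rw [Function.comp_apply, Function.comp_apply, ← (hf x y hy).2,
    (extChartAt J (f x)).left_inv (hf x y hy).1]

theorem mdifferentiableAt (hf : IsLinearInCharts I J f L) (x : M) : MDifferentiableAt I J f x :=
  hf.contMDiff.contMDiffAt.mdifferentiableAt (by simp)

variable [IsManifold I ∞ M]

theorem tderiv_extChartAt_comp_tderiv (hf : IsLinearInCharts I J f L) {x₀ x : M}
    (hx : x ∈ (extChartAt I x₀).source) :
    tderiv J 𝓘(ℝ, E') (extChartAt J (f x₀)) (f x) ∘L tderiv I J f x =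
      L ∘L tderiv I 𝓘(ℝ, E) (extChartAt I x₀) x := by
  rw [← tderiv_comp x (mdifferentiableAt_extChartAt_of_mem_source (hf x₀ x hx).1)
      (hf.mdifferentiableAt x), tderiv_congr (hf.eventuallyEq hx),
    tderiv_comp x L.differentiableAt.mdifferentiableAt
      (mdifferentiableAt_extChartAt_of_mem_source hx), tderiv_eq_fderiv, L.fderiv]

theorem tderiv_eq (hf : IsLinearInCharts I J f L) (x : M) : tderiv I J f x = L := by
  have h := hf.tderiv_extChartAt_comp_tderiv (mem_extChartAt_source (I := I) x)
  rwa [tderiv_extChartAt_self, tderiv_extChartAt_self, ContinuousLinearMap.comp_id,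
    ContinuousLinearMap.id_comp] at h

theorem tderiv_extChartAt_comp (hf : IsLinearInCharts I J f L) {x₀ x : M}
    (hx : x ∈ (extChartAt I x₀).source) :
    tderiv J 𝓘(ℝ, E') (extChartAt J (f x₀)) (f x) ∘L L =
      L ∘L tderiv I 𝓘(ℝ, E) (extChartAt I x₀) x := by
  rw [← hf.tderiv_extChartAt_comp_tderiv hx, hf.tderiv_eq]

end IsLinearInCharts

end LinearInCharts

section Forms

variable {E : Type*} [NormedAddCommGroup E] [NormedSpace ℝ E]
  {H : Type*} [TopologicalSpace H] {I : ModelWithCorners ℝ E H}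
  {M : Type*} [TopologicalSpace M] [ChartedSpace H M]
  {E' : Type*} [NormedAddCommGroup E'] [NormedSpace ℝ E']
  {H' : Type*} [TopologicalSpace H'] {J : ModelWithCorners ℝ E' H'}
  {N : Type*} [TopologicalSpace N] [ChartedSpace H' N]
  {E'' : Type*} [NormedAddCommGroup E''] [NormedSpace ℝ E'']
  {H'' : Type*} [TopologicalSpace H''] {K : ModelWithCorners ℝ E'' H''}
  {P : Type*} [TopologicalSpace P] [ChartedSpace H'' P]
  {k : ℕ}

namespace DiffForm

/-- The value of a form at a point, read as an alternating map on the model vector space, in the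
same way as `tderiv` reads the derivative of a map. -/
def coef (η : DiffForm I M k) (x : M) : E [⋀^Fin k]→L[ℝ] ℝ := η x

/-- A family of alternating maps on a vector space, as a form on that space considered as a
manifold. -/
def ofModel (η₀ : E → E [⋀^Fin k]→L[ℝ] ℝ) : DiffForm 𝓘(ℝ, E) E k := η₀

theorem ext_coef {η η' : DiffForm I M k} {x : M} (h : coef η x = coef η' x) : η x = η' x := h

theorem coef_pullback (f : M → N) (η : DiffForm J N k) (x : M) :
    coef (pullback I J f η) x = (coef η (f x)).compContinuousLinearMap (tderiv I J f x) := rfl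

theorem pullback_comp {g : N → P} {f : M → N} {x : M} (hg : MDifferentiableAt J K g (f x))
    (hf : MDifferentiableAt I J f x) (η : DiffForm K P k) :
    pullback I K (g ∘ f) η x = pullback I J f (pullback J K g η) x := by
  apply ext_coef
  rw [coef_pullback, coef_pullback, coef_pullback, tderiv_comp x hg hf]
  rfl

theorem d_congr {η η' : DiffForm I M k} {x : M} (h : ∀ᶠ y in 𝓝 x, η y = η' y) :
    d I η x = d I η' x := by
  have hφ := tendsto_extChartAt_symm (I := I) x
  have hchart : inChart I η x =ᶠ[𝓝 (extChartAt I x x)] inChart I η' x := by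
    filter_upwards [hφ.eventually h] with y hy
    simp only [inChart, hy]
  unfold d
  rw [hchart.extDerivWithin_eq_nhds]

section ExteriorDerivative

variable [I.Boundaryless]

theorem coef_inChart (η : DiffForm I M k) (x₀ : M) (y : E) :
    inChart I η x₀ y = (coef η ((extChartAt I x₀).symm y)).compContinuousLinearMap
      (tderiv 𝓘(ℝ, E) I (extChartAt I x₀).symm y) := by
  unfold inChart
  rw [I.range_eq_univ, mfderivWithin_univ]
  rfl

theorem coef_d [IsManifold I 1 M] (η : DiffForm I M k) (x : M) :
    coef (d I η) x = extDeriv (inChart I η x) (extChartAt I x x) := by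
  change (extDerivWithin (inChart I η x) (range I) (extChartAt I x x)).compContinuousLinearMap
    (tderiv I 𝓘(ℝ, E) (extChartAt I x) x) = _
  rw [tderiv_extChartAt_self, I.range_eq_univ, extDerivWithin_univ]
  rfl

theorem inChart_pullback_eventuallyEq [J.Boundaryless] [IsManifold I 1 M] [IsManifold J 1 N]
    {f : M → N} {x : M} (hf : ContMDiffAt I J ∞ f x) (η : DiffForm J N k) :
    inChart I (pullback I J f η) x =ᶠ[𝓝 (extChartAt I x x)]
      fun y => (inChart J η (f x) (writtenInExtChartAt I J x f y)).compContinuousLinearMap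
        (fderiv ℝ (writtenInExtChartAt I J x f) y) := by
  have hφ := tendsto_extChartAt_symm (I := I) x
  filter_upwards [extChartAt_target_mem_nhds (I := I) x,
    hφ.eventually (hf.continuousAt.preimage_mem_nhds (extChartAt_source_mem_nhds (I := J) (f x))),
    hφ.eventually (eventually_mdifferentiableAt hf)] with y hy hfy hdiff
  have hderiv := fderiv_writtenInExtChartAt ((extChartAt I x).map_target hy) hfy hdiff
  rw [(extChartAt I x).right_inv hy] at hderiv
  ext v
  have hw : writtenInExtChartAt I J x f y = extChartAt J (f x) (f ((extChartAt I x).symm y)) := rfl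
  simp only [coef_inChart, coef_pullback, hderiv, hw, (extChartAt J (f x)).left_inv hfy,
    ContinuousAlternatingMap.compContinuousLinearMap_apply]
  congr 1
  funext i
  exact (DFunLike.congr_fun (tderiv_extChartAt_symm_comp hfy) _).symm

theorem d_pullback [J.Boundaryless] [IsManifold I 1 M] [IsManifold J 1 N] {f : M → N} {x : M}
    (hf : ContMDiffAt I J ∞ f x) {η : DiffForm J N k}
    (hη : DifferentiableAt ℝ (inChart J η (f x)) (extChartAt J (f x) (f x))) :
    d I (pullback I J f η) x = pullback I J f (d J η) x := by
  have hfx : writtenInExtChartAt I J x f (extChartAt I x x) = extChartAt J (f x) (f x) :=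
    congrArg (extChartAt J (f x) ∘ f) (extChartAt_to_inv x)
  have hmodel := extDeriv_pullback (hfx ▸ hη) (contDiffAt_writtenInExtChartAt hf)
    (by simpa using (mod_cast le_top : ((2 : ℕ∞) : WithTop ℕ∞) ≤ ∞))
  apply ext_coef
  rw [coef_pullback, coef_d, coef_d, (inChart_pullback_eventuallyEq hf η).extDeriv_eq, hmodel, hfx,
    fderiv_writtenInExtChartAt_self (hf.mdifferentiableAt (by simp))]

end ExteriorDerivative

theorem inChart_ofModel (η₀ : E → E [⋀^Fin k]→L[ℝ] ℝ) (x₀ : E) :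
    inChart 𝓘(ℝ, E) (ofModel η₀) x₀ = η₀ := by
  funext y
  have hid : tderiv 𝓘(ℝ, E) 𝓘(ℝ, E) (extChartAt 𝓘(ℝ, E) x₀).symm y = ContinuousLinearMap.id ℝ E :=
    tderiv_id y
  rw [coef_inChart, hid]
  rfl

theorem d_ofModel (η₀ : E → E [⋀^Fin k]→L[ℝ] ℝ) :
    d 𝓘(ℝ, E) (ofModel η₀) = ofModel (extDeriv η₀) := by
  funext y
  apply ext_coef
  rw [coef_d, inChart_ofModel]
  rfl

/-- `η` has the coordinate expression `η₀` in the preferred chart around `x₀`. -/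
def HasChartExpr (η : DiffForm I M k) (x₀ : M) (η₀ : E → E [⋀^Fin k]→L[ℝ] ℝ) : Prop :=
  ∀ x ∈ (extChartAt I x₀).source,
    η x = pullback I 𝓘(ℝ, E) (extChartAt I x₀) (ofModel η₀) x

namespace HasChartExpr

variable {η η' : DiffForm I M k} {x₀ : M} {η₀ η₀' : E → E [⋀^Fin k]→L[ℝ] ℝ}

theorem coef_eq (h : HasChartExpr η x₀ η₀) {x : M} (hx : x ∈ (extChartAt I x₀).source) :
    coef η x = (η₀ (extChartAt I x₀ x)).compContinuousLinearMap
      (tderiv I 𝓘(ℝ, E) (extChartAt I x₀) x) :=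
  h x hx

theorem coef_self [IsManifold I 1 M] (h : HasChartExpr η x₀ η₀) :
    coef η x₀ = η₀ (extChartAt I x₀ x₀) := by
  rw [h.coef_eq (mem_extChartAt_source x₀), tderiv_extChartAt_self]
  rfl

theorem add (h : HasChartExpr η x₀ η₀) (h' : HasChartExpr η' x₀ η₀') :
    HasChartExpr (η + η') x₀ (η₀ + η₀') := by
  intro x hx
  rw [Pi.add_apply, h x hx, h' x hx]
  rfl

theorem sub (h : HasChartExpr η x₀ η₀) (h' : HasChartExpr η' x₀ η₀') :
    HasChartExpr (η - η') x₀ (η₀ - η₀') := by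
  intro x hx
  rw [Pi.sub_apply, h x hx, h' x hx]
  rfl

theorem neg (h : HasChartExpr η x₀ η₀) : HasChartExpr (-η) x₀ (-η₀) := by
  intro x hx
  rw [Pi.neg_apply, h x hx]
  rfl

theorem pullback [IsManifold I ∞ M] [IsManifold J ∞ N] [J.Boundaryless] {f : M → N}
    {L : E →L[ℝ] E'} (hf : IsLinearInCharts I J f L) {ζ : DiffForm J N k}
    {ζ₀ : E' → E' [⋀^Fin k]→L[ℝ] ℝ} (h : HasChartExpr ζ (f x₀) ζ₀) :
    HasChartExpr (pullback I J f ζ) x₀ fun y => (ζ₀ (L y)).compContinuousLinearMap L := by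
  intro x hx
  apply ext_coef
  ext v
  rw [coef_pullback, h.coef_eq (hf x₀ x hx).1, (hf x₀ x hx).2]
  exact congrArg (ζ₀ _) (funext fun i =>
    DFunLike.congr_fun (hf.tderiv_extChartAt_comp_tderiv hx) (v i))

variable [I.Boundaryless]

theorem inChart_eqOn [IsManifold I 1 M] (h : HasChartExpr η x₀ η₀) :
    EqOn (inChart I η x₀) η₀ (extChartAt I x₀).target := by
  intro y hy
  have hx := (extChartAt I x₀).map_target hy
  have hcomp := tderiv_extChartAt_comp hx
  rw [(extChartAt I x₀).right_inv hy] at hcomp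
  ext v
  rw [coef_inChart, h.coef_eq hx, (extChartAt I x₀).right_inv hy]
  exact congrArg (η₀ y) (funext fun i => DFunLike.congr_fun hcomp (v i))

variable [IsManifold I ∞ M]

theorem differentiableAt_inChart (h : HasChartExpr η x₀ η₀) (hη : Differentiable ℝ η₀) :
    DifferentiableAt ℝ (inChart I η x₀) (extChartAt I x₀ x₀) :=
  (hη _).congr_of_eventuallyEq (h.inChart_eqOn.eventuallyEq_of_mem (extChartAt_target_mem_nhds x₀))

protected theorem d (h : HasChartExpr η x₀ η₀) (hη : Differentiable ℝ η₀) :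
    HasChartExpr (d I η) x₀ (extDeriv η₀) := by
  intro x hx
  have hφ : ContMDiffAt I 𝓘(ℝ, E) ∞ (extChartAt I x₀) x :=
    contMDiffAt_extChartAt' (by rwa [← extChartAt_source I])
  rw [← d_ofModel, ← d_pullback hφ (by rw [inChart_ofModel]; exact hη _)]
  apply d_congr
  filter_upwards [extChartAt_source_mem_nhds' hx] with y hy using h y hy

end HasChartExpr

theorem extDeriv_const (c : E [⋀^Fin k]→L[ℝ] ℝ) (x : E) : extDeriv (fun _ => c) x = 0 := by
  ext v
  simp [extDeriv, ContinuousAlternatingMap.alternatizeUncurryFin_apply]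

theorem IsSymplectic.of_hasChartExpr_const [I.Boundaryless] [IsManifold I ∞ M]
    {η : DiffForm I M 2} {c : E [⋀^Fin 2]→L[ℝ] ℝ} (h : ∀ x₀ : M, HasChartExpr η x₀ fun _ => c)
    (hc : ∀ v, (∀ w, c ![v, w] = 0) → v = 0) : IsSymplectic I η where
  smooth x₀ := contDiffOn_const.congr (h x₀).inChart_eqOn
  closed := by
    funext x
    apply ext_coef
    rw [((h x).d (differentiable_const c)).coef_self]
    exact extDeriv_const c _
  nondegenerate x v hv := hc v fun w => by
    rw [← (h x).coef_self]
    exact hv w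

end DiffForm

end Forms

section BundleCharts

variable {E : Type*} [NormedAddCommGroup E] [NormedSpace ℝ E]
  {H : Type*} [TopologicalSpace H] {I : ModelWithCorners ℝ E H}
  {M : Type*} [TopologicalSpace M] [ChartedSpace H M]

theorem IsLinearInCharts.totalSpaceProj {F : Type*} [NormedAddCommGroup F] [NormedSpace ℝ F]
    {V : M → Type*} [TopologicalSpace (TotalSpace F V)] [∀ x, TopologicalSpace (V x)]
    [FiberBundle F V] :
    IsLinearInCharts (I.prod 𝓘(ℝ, F)) I (TotalSpace.proj : TotalSpace F V → M)
      (ContinuousLinearMap.fst ℝ E F) := by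
  intro v₀ v hv
  rw [FiberBundle.extChartAt] at hv ⊢
  simp only [mfld_simps] at hv ⊢
  have hfst := Trivialization.coe_fst (trivializationAt F V v₀.proj) (x := v) (by simpa using hv.1)
  exact ⟨hfst ▸ hv.2, by rw [hfst]; rfl⟩

/-- The coordinates of a tangent vector in the preferred chart at its base point. -/
def tangentVec (v : TangentBundle I M) : E := v.snd

/-- The coordinates of a covector in the preferred chart at its base point. -/
def CotangentBundle.covec (α : CotangentBundle I M) : E →L[ℝ] ℝ := α.snd

theorem tangentBundle_ext {v w : TangentBundle I M} (h : v.proj = w.proj)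
    (h' : tangentVec v = tangentVec w) : v = w := by
  obtain ⟨x, v⟩ := v
  obtain ⟨y, w⟩ := w
  obtain rfl : x = y := h
  exact congrArg _ h'

theorem CotangentBundle.ext {α β : CotangentBundle I M} (h : α.proj = β.proj)
    (h' : covec α = covec β) : α = β := by
  obtain ⟨x, α⟩ := α
  obtain ⟨y, β⟩ := β
  obtain rfl : x = y := h
  exact congrArg _ h'

variable [IsManifold I ∞ M]

theorem mem_extChartAt_tangentBundle_source {v₀ v : TangentBundle I M} :
    v ∈ (extChartAt I.tangent v₀).source ↔ v.proj ∈ (extChartAt I v₀.proj).source := by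
  rw [extChartAt_source, extChartAt_source, TangentBundle.mem_chart_source_iff]

theorem extChartAt_tangentBundle {v₀ v : TangentBundle I M}
    (hv : v.proj ∈ (extChartAt I v₀.proj).source) :
    extChartAt I.tangent v₀ v = (extChartAt I v₀.proj v.proj,
      tderiv I 𝓘(ℝ, E) (extChartAt I v₀.proj) v.proj (tangentVec v)) := by
  have hmfderiv := TangentBundle.continuousLinearMapAt_trivializationAt (I := I) (x₀ := v₀.proj)
    (x := v.proj) (by simpa using hv)
  have hcore := TangentBundle.continuousLinearMapAt_trivializationAt_eq_core (I := I)
    (b₀ := v₀.proj) (b := v.proj) (by simpa using hv)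
  exact Prod.ext (IsLinearInCharts.totalSpaceProj v₀ v (mem_extChartAt_tangentBundle_source.2 hv)).2
    (DFunLike.congr_fun (hcore.symm.trans hmfderiv) v.snd)

theorem IsLinearInCharts.zeroSection :
    IsLinearInCharts I I.tangent (fun x : M => (⟨x, 0⟩ : TangentBundle I M))
      (ContinuousLinearMap.inl ℝ E E) := by
  intro x₀ x hx
  refine ⟨mem_extChartAt_tangentBundle_source.2 hx, ?_⟩
  rw [extChartAt_tangentBundle hx]
  exact Prod.ext rfl (map_zero (tderiv I 𝓘(ℝ, E) (extChartAt I x₀) x))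

theorem IsLinearInCharts.tangentMap {E' : Type*} [NormedAddCommGroup E'] [NormedSpace ℝ E']
    {H' : Type*} [TopologicalSpace H'] {J : ModelWithCorners ℝ E' H'}
    {N : Type*} [TopologicalSpace N] [ChartedSpace H' N] [IsManifold J ∞ N] [J.Boundaryless]
    {f : M → N} {L : E →L[ℝ] E'} (hf : IsLinearInCharts I J f L) :
    IsLinearInCharts I.tangent J.tangent (tangentMap I J f) (L.prodMap L) := by
  intro v₀ v hv
  rw [mem_extChartAt_tangentBundle_source] at hv
  have hfv := hf v₀.proj v.proj hv
  refine ⟨mem_extChartAt_tangentBundle_source.2 hfv.1, ?_⟩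
  rw [extChartAt_tangentBundle hv, extChartAt_tangentBundle hfv.1]
  exact Prod.ext hfv.2 (DFunLike.congr_fun (hf.tderiv_extChartAt_comp_tderiv hv) (tangentVec v))

namespace CotangentBundle

theorem mem_extChartAt_source {α₀ α : CotangentBundle I M} :
    α ∈ (extChartAt I.cotangent α₀).source ↔ α.proj ∈ (extChartAt I α₀.proj).source := by
  rw [FiberBundle.extChartAt]
  simp only [mfld_simps]
  exact ⟨fun h => h.1.1, fun h => ⟨⟨h, trivial⟩, h⟩⟩

variable [I.Boundaryless]

theorem extChartAt_eq {α₀ α : CotangentBundle I M}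
    (hα : α.proj ∈ (extChartAt I α₀.proj).source) :
    extChartAt I.cotangent α₀ α = (extChartAt I α₀.proj α.proj,
      covec α ∘L
        tderiv 𝓘(ℝ, E) I (extChartAt I α₀.proj).symm (extChartAt I α₀.proj α.proj)) := by
  have hsymm := TangentBundle.symmL_trivializationAt (I := I) (x₀ := α₀.proj)
    (x := α.proj) (by simpa using hα)
  rw [I.range_eq_univ, mfderivWithin_univ] at hsymm
  refine Prod.ext (IsLinearInCharts.totalSpaceProj α₀ α (mem_extChartAt_source.2 hα)).2 ?_
  rw [FiberBundle.extChartAt]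
  ext w
  change (trivializationAt ℝ (Bundle.Trivial M ℝ) α₀.proj).continuousLinearMapAt ℝ α.proj
    (α.snd ((trivializationAt E (TangentSpace I) α₀.proj).symmL ℝ α.proj w)) = _
  exact (DFunLike.congr_fun
    (Bundle.Trivial.continuousLinearMapAt_trivialization ℝ M ℝ α.proj) _).trans
      (congrArg (covec α) (DFunLike.congr_fun hsymm w))

theorem extChartAt_snd_comp {α₀ α : CotangentBundle I M}
    (hα : α.proj ∈ (extChartAt I α₀.proj).source) :
    (extChartAt I.cotangent α₀ α).2 ∘L tderiv I 𝓘(ℝ, E) (extChartAt I α₀.proj) α.proj =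
      covec α := by
  rw [extChartAt_eq hα, ContinuousLinearMap.comp_assoc, tderiv_extChartAt_symm_comp hα,
    ContinuousLinearMap.comp_id]

theorem extChartAt_eq_of_comp_eq {α₀ α : CotangentBundle I M}
    (hα : α.proj ∈ (extChartAt I α₀.proj).source) {c : E →L[ℝ] ℝ}
    (hc : c ∘L tderiv I 𝓘(ℝ, E) (extChartAt I α₀.proj) α.proj = covec α) :
    extChartAt I.cotangent α₀ α = (extChartAt I α₀.proj α.proj, c) := by
  rw [extChartAt_eq hα, ← hc, ContinuousLinearMap.comp_assoc, tderiv_extChartAt_comp hα,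
    ContinuousLinearMap.comp_id]

theorem contMDiffAt_of_coordinates {E' : Type*} [NormedAddCommGroup E'] [NormedSpace ℝ E']
    {H' : Type*} [TopologicalSpace H'] {J : ModelWithCorners ℝ E' H'}
    {N : Type*} [TopologicalSpace N] [ChartedSpace H' N] {f : N → CotangentBundle I M} {x₀ : N}
    (hproj : ContMDiffAt J I ∞ (fun x => (f x).proj) x₀) {c : N → E →L[ℝ] ℝ}
    (hc : ContMDiffAt J 𝓘(ℝ, E →L[ℝ] ℝ) ∞ c x₀)
    (h : ∀ᶠ x in 𝓝 x₀, c x ∘L tderiv I 𝓘(ℝ, E) (extChartAt I (f x₀).proj) (f x).proj =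
      covec (f x)) :
    ContMDiffAt J I.cotangent ∞ f x₀ := by
  refine contMDiffAt_totalSpace.2 ⟨hproj, hc.congr_of_eventuallyEq ?_⟩
  filter_upwards [h, hproj.continuousAt.preimage_mem_nhds (extChartAt_source_mem_nhds (I := I) _)]
    with x hx hsource
  exact congrArg Prod.snd (extChartAt_eq_of_comp_eq (α₀ := f x₀) hsource hx)

end CotangentBundle

end BundleCharts

section BilinearForms

variable {F : Type*} [NormedAddCommGroup F] [NormedSpace ℝ F]

/-- The 1-form `x ↦ A x` on a vector space, whose coefficients are linear in `x`. -/
def linearOneForm (A : F →L[ℝ] F →L[ℝ] ℝ) : F →L[ℝ] F [⋀^Fin 1]→L[ℝ] ℝ :=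
  (ContinuousAlternatingMap.ofSubsingletonLIE (𝕜 := ℝ) (E := F) (F := ℝ) (0 : Fin 1) :
    (F →L[ℝ] ℝ) →L[ℝ] F [⋀^Fin 1]→L[ℝ] ℝ) ∘L A

/-- The skew-symmetrization `(v, w) ↦ A v w - A w v` of a bilinear form. -/
def skewForm (A : F →L[ℝ] F →L[ℝ] ℝ) : F [⋀^Fin 2]→L[ℝ] ℝ :=
  ContinuousAlternatingMap.alternatizeUncurryFin (linearOneForm A)

theorem linearOneForm_apply (A : F →L[ℝ] F →L[ℝ] ℝ) (x : F) (v : Fin 1 → F) :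
    linearOneForm A x v = A x (v 0) := rfl

theorem skewForm_apply (A : F →L[ℝ] F →L[ℝ] ℝ) (v : Fin 2 → F) :
    skewForm A v = A (v 0) (v 1) - A (v 1) (v 0) := by
  simp [skewForm, ContinuousAlternatingMap.alternatizeUncurryFin_apply, linearOneForm_apply,
    Fin.removeNth, sub_eq_add_neg]

theorem extDeriv_linearOneForm (A : F →L[ℝ] F →L[ℝ] ℝ) :
    extDeriv (linearOneForm A) = fun _ => skewForm A := by
  funext x
  rw [extDeriv, ContinuousLinearMap.fderiv, skewForm]

/-- The bilinear form `((q, p), (u, w)) ↦ p u` on `F × F^*`: the coefficients of the Liouville form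
in induced coordinates. -/
def liouvilleBilin (F : Type*) [NormedAddCommGroup F] [NormedSpace ℝ F] :
    (F × (F →L[ℝ] ℝ)) →L[ℝ] (F × (F →L[ℝ] ℝ)) →L[ℝ] ℝ :=
  (ContinuousLinearMap.id ℝ (F →L[ℝ] ℝ)).bilinearComp
    (ContinuousLinearMap.snd ℝ F (F →L[ℝ] ℝ)) (ContinuousLinearMap.fst ℝ F (F →L[ℝ] ℝ))

/-- The bilinear form `((q, p), (u, w)) ↦ -p u` on `F × F^*`, whose skew-symmetrization is the
canonical symplectic form `dq ∧ dp`. -/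
def canonicalBilin (F : Type*) [NormedAddCommGroup F] [NormedSpace ℝ F] :
    (F × (F →L[ℝ] ℝ)) →L[ℝ] (F × (F →L[ℝ] ℝ)) →L[ℝ] ℝ :=
  (-ContinuousLinearMap.id ℝ (F →L[ℝ] ℝ)).bilinearComp
    (ContinuousLinearMap.snd ℝ F (F →L[ℝ] ℝ)) (ContinuousLinearMap.fst ℝ F (F →L[ℝ] ℝ))

/-- The complete lift of a bilinear form: `d_T` acts on forms with coefficients `A` by this
operation. -/
def tangentBilin (A : F →L[ℝ] F →L[ℝ] ℝ) : (F × F) →L[ℝ] (F × F) →L[ℝ] ℝ :=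
  A.bilinearComp (ContinuousLinearMap.snd ℝ F F) (ContinuousLinearMap.fst ℝ F F) +
    A.bilinearComp (ContinuousLinearMap.fst ℝ F F) (ContinuousLinearMap.snd ℝ F F)

/-- The bilinear form `pr₂^* A - pr₁^* A` on `F × F`. -/
def diffBilin (A : F →L[ℝ] F →L[ℝ] ℝ) : (F × F) →L[ℝ] (F × F) →L[ℝ] ℝ :=
  A.bilinearComp (ContinuousLinearMap.snd ℝ F F) (ContinuousLinearMap.snd ℝ F F) -
    A.bilinearComp (ContinuousLinearMap.fst ℝ F F) (ContinuousLinearMap.fst ℝ F F)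

theorem liouvilleBilin_apply (z w : F × (F →L[ℝ] ℝ)) : liouvilleBilin F z w = z.2 w.1 := rfl

theorem canonicalBilin_apply (z w : F × (F →L[ℝ] ℝ)) : canonicalBilin F z w = -z.2 w.1 := rfl

theorem tangentBilin_apply (A : F →L[ℝ] F →L[ℝ] ℝ) (z w : F × F) :
    tangentBilin A z w = A z.2 w.1 + A z.1 w.2 := rfl

theorem diffBilin_apply (A : F →L[ℝ] F →L[ℝ] ℝ) (z w : F × F) :
    diffBilin A z w = A z.2 w.2 - A z.1 w.1 := rfl

theorem skewForm_canonicalBilin : skewForm (canonicalBilin F) = -skewForm (liouvilleBilin F) := by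
  ext v
  rw [ContinuousAlternatingMap.neg_apply, skewForm_apply, skewForm_apply, canonicalBilin_apply,
    canonicalBilin_apply, liouvilleBilin_apply, liouvilleBilin_apply]
  ring

theorem skewForm_canonicalBilin_nondegenerate (z : F × (F →L[ℝ] ℝ))
    (h : ∀ w, skewForm (canonicalBilin F) ![z, w] = 0) : z = 0 := by
  simp only [skewForm_apply, canonicalBilin_apply, Matrix.cons_val_zero, Matrix.cons_val_one] at h
  refine Prod.ext ?_ ?_
  · exact SeparatingDual.eq_zero_of_forall_dual_eq_zero (R := ℝ) fun f => by simpa using h (0, f)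
  · ext u
    simpa using h (u, 0)

theorem skewForm_tangentBilin_nondegenerate {A : F →L[ℝ] F →L[ℝ] ℝ}
    (hA : ∀ v, (∀ w, skewForm A ![v, w] = 0) → v = 0) (z : F × F)
    (h : ∀ w, skewForm (tangentBilin A) ![z, w] = 0) : z = 0 := by
  simp only [skewForm_apply, tangentBilin_apply, Matrix.cons_val_zero, Matrix.cons_val_one] at hA h
  refine Prod.ext (hA z.1 fun w => ?_) (hA z.2 fun w => ?_)
  · simpa using h (0, w)
  · simpa using h (w, 0)

theorem skewForm_diffBilin (A : F →L[ℝ] F →L[ℝ] ℝ) :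
    skewForm (diffBilin A) =
      (skewForm A).compContinuousLinearMap (ContinuousLinearMap.snd ℝ F F) -
        (skewForm A).compContinuousLinearMap (ContinuousLinearMap.fst ℝ F F) := by
  ext v
  simp only [skewForm_apply, diffBilin_apply, ContinuousAlternatingMap.coe_sub, Pi.sub_apply,
    ContinuousAlternatingMap.compContinuousLinearMap_apply, ContinuousLinearMap.coe_snd',
    ContinuousLinearMap.coe_fst', Function.comp_apply]
  ring

theorem skewForm_diffBilin_nondegenerate {A : F →L[ℝ] F →L[ℝ] ℝ}
    (hA : ∀ v, (∀ w, skewForm A ![v, w] = 0) → v = 0) (z : F × F)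
    (h : ∀ w, skewForm (diffBilin A) ![z, w] = 0) : z = 0 := by
  simp only [skewForm_apply, diffBilin_apply, Matrix.cons_val_zero, Matrix.cons_val_one] at hA h
  refine Prod.ext (hA z.1 fun w => ?_) (hA z.2 fun w => ?_)
  · simpa [neg_add_eq_zero, sub_eq_zero] using h (w, 0)
  · simpa using h (0, w)

end BilinearForms

section ChartExpressions

variable {E : Type*} [NormedAddCommGroup E] [NormedSpace ℝ E]
  {H : Type*} [TopologicalSpace H] {I : ModelWithCorners ℝ E H}
  {M : Type*} [TopologicalSpace M] [ChartedSpace H M] [I.Boundaryless] [IsManifold I ∞ M]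
  {k : ℕ}

namespace DiffForm

theorem coef_liouvilleForm_apply (α : CotangentBundle I M) (X : Fin 1 → E × (E →L[ℝ] ℝ)) :
    coef (liouvilleForm I M) α X = α.covec (X 0).1 := by
  change α.covec (tderiv I.cotangent I (cotangentProj I) α (X 0)) = _
  rw [IsLinearInCharts.totalSpaceProj.tderiv_eq]
  rfl

theorem coef_iT_apply (η : DiffForm I M (k + 1)) (v : TangentBundle I M) (X : Fin k → E × E) :
    coef (iT I η) v X = coef η v.proj (Matrix.vecCons (tangentVec v) fun i => (X i).1) := by
  change coef η v.proj (Matrix.vecCons (tangentVec v) fun i => tderiv I.tangent I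
    (TotalSpace.proj : TangentBundle I M → M) v (X i)) = _
  rw [IsLinearInCharts.totalSpaceProj.tderiv_eq]
  rfl

/-- The coordinate expression of `i_T η` in terms of the one of `η`. -/
def iTModel (η₀ : E → E [⋀^Fin (k + 1)]→L[ℝ] ℝ) (z : E × E) : (E × E) [⋀^Fin k]→L[ℝ] ℝ :=
  ((η₀ z.1).curryLeft z.2).compContinuousLinearMap (ContinuousLinearMap.fst ℝ E E)

theorem iTModel_apply (η₀ : E → E [⋀^Fin (k + 1)]→L[ℝ] ℝ) (z : E × E) (X : Fin k → E × E) :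
    iTModel η₀ z X = η₀ z.1 (Matrix.vecCons z.2 fun i => (X i).1) := rfl

theorem iTModel_linearOneForm (A : E →L[ℝ] E →L[ℝ] ℝ) :
    iTModel (linearOneForm A) =
      fun z => ContinuousAlternatingMap.constOfIsEmpty ℝ (E × E) (Fin 0) (A z.1 z.2) := rfl

theorem iTModel_skewForm (A : E →L[ℝ] E →L[ℝ] ℝ) :
    iTModel (fun _ => skewForm A) = linearOneForm ((A - A.flip).bilinearComp
      (ContinuousLinearMap.snd ℝ E E) (ContinuousLinearMap.fst ℝ E E)) := by
  funext z
  ext X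
  simp [iTModel_apply, linearOneForm_apply, skewForm_apply]

theorem iTModel_extDeriv_add_extDeriv_iTModel_linearOneForm (A : E →L[ℝ] E →L[ℝ] ℝ) :
    iTModel (extDeriv (linearOneForm A)) + extDeriv (iTModel (linearOneForm A)) =
      linearOneForm (tangentBilin A) := by
  funext z
  ext X
  have hA := A.hasFDerivAt_of_bilinear (hasFDerivAt_fst (𝕜 := ℝ) (p := z))
    (hasFDerivAt_snd (𝕜 := ℝ) (p := z))
  rw [Pi.add_apply, iTModel_linearOneForm, extDeriv_linearOneForm, extDeriv_constOfIsEmpty,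
    hA.fderiv, ContinuousAlternatingMap.add_apply, linearOneForm_apply, tangentBilin_apply]
  simp [iTModel_apply, skewForm_apply]

theorem iTModel_extDeriv_add_extDeriv_iTModel_skewForm (A : E →L[ℝ] E →L[ℝ] ℝ) :
    iTModel (extDeriv fun _ => skewForm A) + extDeriv (iTModel fun _ => skewForm A) =
      fun _ => skewForm (tangentBilin A) := by
  funext z
  ext X
  rw [Pi.add_apply, iTModel_skewForm, extDeriv_linearOneForm, ContinuousAlternatingMap.add_apply,
    iTModel_apply, extDeriv_const, skewForm_apply, skewForm_apply, tangentBilin_apply,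
    tangentBilin_apply]
  simp only [ContinuousAlternatingMap.coe_zero, Pi.zero_apply, zero_add, sub_apply,
    ContinuousLinearMap.bilinearComp_apply, ContinuousLinearMap.coe_snd',
    ContinuousLinearMap.coe_fst', ContinuousLinearMap.flip_apply]
  ring

namespace HasChartExpr

variable {v₀ : TangentBundle I M}

protected theorem iT {η : DiffForm I M (k + 1)} {η₀ : E → E [⋀^Fin (k + 1)]→L[ℝ] ℝ}
    (h : HasChartExpr η v₀.proj η₀) : HasChartExpr (iT I η) v₀ (iTModel η₀) := by
  intro v hv
  have hx := mem_extChartAt_tangentBundle_source.1 hv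
  apply ext_coef
  ext X
  rw [coef_iT_apply, h.coef_eq hx, coef_pullback, extChartAt_tangentBundle hx]
  refine congrArg (η₀ (extChartAt I v₀.proj v.proj)) (funext (Fin.cases rfl fun i => ?_))
  exact (DFunLike.congr_fun (IsLinearInCharts.totalSpaceProj.tderiv_extChartAt_comp hv) (X i))

protected theorem dT {η : DiffForm I M (k + 1)} {η₀ : E → E [⋀^Fin (k + 1)]→L[ℝ] ℝ}
    (h : HasChartExpr η v₀.proj η₀) (hη : Differentiable ℝ η₀)
    (hiT : Differentiable ℝ (iTModel η₀)) :
    HasChartExpr (dT I η) v₀ (iTModel (extDeriv η₀) + extDeriv (iTModel η₀)) :=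
  (h.d hη).iT.add (h.iT.d hiT)

theorem dT_linearOneForm {η : DiffForm I M 1} {A : E →L[ℝ] E →L[ℝ] ℝ}
    (h : HasChartExpr η v₀.proj (linearOneForm A)) :
    HasChartExpr (dT I η) v₀ (linearOneForm (tangentBilin A)) := by
  rw [← iTModel_extDeriv_add_extDeriv_iTModel_linearOneForm]
  refine h.dT (linearOneForm A).differentiable ?_
  rw [iTModel_linearOneForm]
  exact (ContinuousAlternatingMap.constOfIsEmptyLIE ℝ (E × E) ℝ (Fin 0)).differentiable.comp
    (A.isBoundedBilinearMap.differentiable)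

theorem dT_skewForm {η : DiffForm I M 2} {A : E →L[ℝ] E →L[ℝ] ℝ}
    (h : HasChartExpr η v₀.proj fun _ => skewForm A) :
    HasChartExpr (dT I η) v₀ fun _ => skewForm (tangentBilin A) := by
  rw [← iTModel_extDeriv_add_extDeriv_iTModel_skewForm]
  refine h.dT (differentiable_const _) ?_
  rw [iTModel_skewForm]
  exact (linearOneForm _).differentiable

end HasChartExpr

theorem hasChartExpr_liouvilleForm (α₀ : CotangentBundle I M) :
    HasChartExpr (liouvilleForm I M) α₀ (linearOneForm (liouvilleBilin E)) := by
  intro α hα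
  have hx := CotangentBundle.mem_extChartAt_source.1 hα
  apply ext_coef
  ext X
  rw [coef_liouvilleForm_apply, ← CotangentBundle.extChartAt_snd_comp hx]
  exact congrArg (extChartAt I.cotangent α₀ α).2
    (DFunLike.congr_fun (IsLinearInCharts.totalSpaceProj.tderiv_extChartAt_comp hα) (X 0))

theorem hasChartExpr_canonicalForm (α₀ : CotangentBundle I M) :
    HasChartExpr (canonicalForm I M) α₀ fun _ => skewForm (canonicalBilin E) := by
  have h := ((hasChartExpr_liouvilleForm α₀).d (linearOneForm _).differentiable).neg
  rw [extDeriv_linearOneForm] at h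
  rw [skewForm_canonicalBilin]
  exact h

theorem hasChartExpr_dT_liouvilleForm (v₀ : TangentBundle I.cotangent (CotangentBundle I M)) :
    HasChartExpr (dT I.cotangent (liouvilleForm I M)) v₀
      (linearOneForm (tangentBilin (liouvilleBilin E))) :=
  (hasChartExpr_liouvilleForm v₀.proj).dT_linearOneForm

theorem hasChartExpr_dT_canonicalForm (v₀ : TangentBundle I.cotangent (CotangentBundle I M)) :
    HasChartExpr (dT I.cotangent (canonicalForm I M)) v₀
      fun _ => skewForm (tangentBilin (canonicalBilin E)) :=
  (hasChartExpr_canonicalForm v₀.proj).dT_skewForm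

theorem hasChartExpr_omega12 (z₀ : CotangentBundle I M × CotangentBundle I M) :
    HasChartExpr (omega12 I M) z₀ fun _ => skewForm (diffBilin (canonicalBilin E)) := by
  have h := ((hasChartExpr_canonicalForm z₀.2).pullback (IsLinearInCharts.snd _ _)).sub
    ((hasChartExpr_canonicalForm z₀.1).pullback (IsLinearInCharts.fst _ _))
  rw [skewForm_diffBilin]
  exact h

variable (I M)

theorem isSymplectic_dT_canonicalForm :
    IsSymplectic I.cotangent.tangent (dT I.cotangent (canonicalForm I M)) :=
  .of_hasChartExpr_const hasChartExpr_dT_canonicalForm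
    (skewForm_tangentBilin_nondegenerate skewForm_canonicalBilin_nondegenerate)

theorem isSymplectic_omega12 : IsSymplectic (I.cotangent.prod I.cotangent) (omega12 I M) :=
  .of_hasChartExpr_const hasChartExpr_omega12
    (skewForm_diffBilin_nondegenerate skewForm_canonicalBilin_nondegenerate)

end DiffForm

end ChartExpressions

section Diffeomorphisms

variable {E : Type*} [NormedAddCommGroup E] [NormedSpace ℝ E]
  {H : Type*} [TopologicalSpace H] {I : ModelWithCorners ℝ E H}
  {M : Type*} [TopologicalSpace M] [ChartedSpace H M]
  {E' : Type*} [NormedAddCommGroup E'] [NormedSpace ℝ E']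
  {H' : Type*} [TopologicalSpace H'] {J : ModelWithCorners ℝ E' H'}
  {N : Type*} [TopologicalSpace N] [ChartedSpace H' N]
  {E'' : Type*} [NormedAddCommGroup E''] [NormedSpace ℝ E'']
  {H'' : Type*} [TopologicalSpace H''] {K : ModelWithCorners ℝ E'' H''}
  {P : Type*} [TopologicalSpace P] [ChartedSpace H'' P]
  {f : M → N} {A : Set M} {B : Set N}

namespace IsDiffeoOn

theorem contMDiffAt (hf : IsDiffeoOn I J f A B) {x : M} (hx : x ∈ A) : ContMDiffAt I J ∞ f x :=
  hf.2.2.2.1.contMDiffAt (hf.1.mem_nhds hx)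

theorem mdifferentiableAt (hf : IsDiffeoOn I J f A B) {x : M} (hx : x ∈ A) :
    MDifferentiableAt I J f x :=
  (hf.contMDiffAt hx).mdifferentiableAt (by simp)

theorem exists_inverse (hf : IsDiffeoOn I J f A B) :
    ∃ g : N → M, IsDiffeoOn J I g B A ∧ InvOn g f A B := by
  obtain ⟨hA, hB, hfAB, hsmooth, g, hleft, hg⟩ := hf
  have hinv : InvOn g f A B := ⟨hleft, hleft.rightInvOn_image.mono hfAB.image_eq.ge⟩
  exact ⟨g, ⟨hB, hA, hinv.symm.bijOn (hleft.mapsTo hfAB.surjOn) hfAB.mapsTo, hg, f,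
    hinv.2, hsmooth⟩, hinv⟩

theorem comp {g : N → P} {C : Set P} (hg : IsDiffeoOn J K g B C) (hf : IsDiffeoOn I J f A B) :
    IsDiffeoOn I K (g ∘ f) A C := by
  obtain ⟨g', hg', hinvg⟩ := hg.exists_inverse
  obtain ⟨f', hf', hinvf⟩ := hf.exists_inverse
  exact ⟨hf.1, hg.2.1, hg.2.2.1.comp hf.2.2.1,
    hg.2.2.2.1.comp hf.2.2.2.1 hf.2.2.1.mapsTo, f' ∘ g',
    (hinvf.comp hinvg hf.2.2.1.mapsTo hg'.2.2.1.mapsTo).1,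
    hf'.2.2.2.1.comp hg'.2.2.2.1 hg'.2.2.1.mapsTo⟩

theorem tderiv_comp_tderiv (hf : IsDiffeoOn I J f A B) {g : N → M} (hg : IsDiffeoOn J I g B A)
    (hgf : LeftInvOn g f A) {x : M} (hx : x ∈ A) :
    tderiv J I g (f x) ∘L tderiv I J f x = ContinuousLinearMap.id ℝ E := by
  rw [← tderiv_comp x (hg.mdifferentiableAt (hf.2.2.1.mapsTo hx)) (hf.mdifferentiableAt hx),
    ← tderiv_id (I := I) x]
  exact tderiv_congr (Filter.eventuallyEq_of_mem (hf.1.mem_nhds hx) hgf)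

theorem inverse_tderiv (hf : IsDiffeoOn I J f A B) {g : N → M} (hg : IsDiffeoOn J I g B A)
    (hinv : InvOn g f A B) {x : M} (hx : x ∈ A) :
    (tderiv I J f x).inverse = tderiv J I g (f x) := by
  have hright := hg.tderiv_comp_tderiv hf hinv.2 (hf.2.2.1.mapsTo hx)
  rw [hinv.1 hx] at hright
  exact ContinuousLinearMap.inverse_eq hright (hf.tderiv_comp_tderiv hg hinv.1 hx)

end IsDiffeoOn

theorem IsSymplectoOn.comp {η₁ : DiffForm I M 2} {η₂ : DiffForm J N 2} {η₃ : DiffForm K P 2}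
    {g : N → P} {C : Set P} (hg : IsSymplectoOn J K η₂ η₃ g B C)
    (hf : IsSymplectoOn I J η₁ η₂ f A B) : IsSymplectoOn I K η₁ η₃ (g ∘ f) A C := by
  refine ⟨hg.1.comp hf.1, fun x hx => ?_⟩
  have hfx := hf.1.2.2.1.mapsTo hx
  rw [DiffForm.pullback_comp (hg.1.mdifferentiableAt hfx) (hf.1.mdifferentiableAt hx), ← hf.2 x hx]
  apply DiffForm.ext_coef
  rw [DiffForm.coef_pullback, DiffForm.coef_pullback]
  exact congrArg (fun c => ContinuousAlternatingMap.compContinuousLinearMap c _) (hg.2 (f x) hfx)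

theorem IsLinearInCharts.symm {f : M ≃ N} {L : E ≃L[ℝ] E'}
    (hf : IsLinearInCharts I J f (L : E →L[ℝ] E'))
    (hsource : ∀ x₀ x, f x ∈ (extChartAt J (f x₀)).source → x ∈ (extChartAt I x₀).source) :
    IsLinearInCharts J I f.symm (L.symm : E' →L[ℝ] E) := by
  intro y₀ y hy
  have hx : f.symm y ∈ (extChartAt I (f.symm y₀)).source :=
    hsource _ _ (by rwa [f.apply_symm_apply, f.apply_symm_apply])
  have hfx := (hf (f.symm y₀) (f.symm y) hx).2
  rw [f.apply_symm_apply, f.apply_symm_apply] at hfx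
  refine ⟨hx, ?_⟩
  rw [hfx]
  exact (L.symm_apply_apply _).symm

theorem isSymplectoOn_of_isLinearInCharts [IsManifold I ∞ M] [IsManifold J ∞ N] [I.Boundaryless]
    [J.Boundaryless] {f : M ≃ N} {L : E →L[ℝ] E'}
    {L' : E' →L[ℝ] E} (hf : IsLinearInCharts I J f L) (hf' : IsLinearInCharts J I f.symm L')
    {η₁ : DiffForm I M 2} {η₂ : DiffForm J N 2} {c₁ : E [⋀^Fin 2]→L[ℝ] ℝ}
    {c₂ : E' [⋀^Fin 2]→L[ℝ] ℝ} (h₁ : ∀ x₀, DiffForm.HasChartExpr η₁ x₀ fun _ => c₁)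
    (h₂ : ∀ y₀, DiffForm.HasChartExpr η₂ y₀ fun _ => c₂)
    (hc : c₂.compContinuousLinearMap L = c₁) (hB : IsOpen B) :
    IsSymplectoOn I J η₁ η₂ f (f ⁻¹' B) B := by
  have hinv : InvOn f.symm f (f ⁻¹' B) B :=
    ⟨fun x _ => f.symm_apply_apply x, fun y _ => f.apply_symm_apply y⟩
  have hmaps : MapsTo f.symm B (f ⁻¹' B) := fun y hy => by
    rwa [mem_preimage, f.apply_symm_apply]
  refine ⟨⟨hB.preimage hf.contMDiff.continuous, hB, hinv.bijOn (mapsTo_preimage f B) hmaps,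
    hf.contMDiff.contMDiffOn, f.symm, hinv.1, hf'.contMDiff.contMDiffOn⟩, fun x _ => ?_⟩
  apply DiffForm.ext_coef
  rw [DiffForm.coef_pullback, hf.tderiv_eq, (h₂ (f x)).coef_self, (h₁ x).coef_self, hc]

end Diffeomorphisms

section LinearLifts

variable {E : Type*} [NormedAddCommGroup E] [NormedSpace ℝ E]
  {H : Type*} [TopologicalSpace H] {I : ModelWithCorners ℝ E H}
  {M : Type*} [TopologicalSpace M] [ChartedSpace H M] [IsManifold I ∞ M]

theorem skewForm_compContinuousLinearMap {F F' : Type*} [NormedAddCommGroup F] [NormedSpace ℝ F]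
    [NormedAddCommGroup F'] [NormedSpace ℝ F'] {A : F' →L[ℝ] F' →L[ℝ] ℝ} {B : F →L[ℝ] F →L[ℝ] ℝ}
    {L : F →L[ℝ] F'} (h : ∀ v w, A (L v) (L w) = B v w) :
    (skewForm A).compContinuousLinearMap L = skewForm B := by
  ext v
  simp only [ContinuousAlternatingMap.compContinuousLinearMap_apply, skewForm_apply,
    Function.comp_apply, h]

variable (E) in
/-- Tulczyjew's map `((q, p), (q̇, ṗ)) ↦ ((q, q̇), (ṗ, p))` in induced coordinates. -/
def tulczyjewModel :
    ((E × (E →L[ℝ] ℝ)) × (E × (E →L[ℝ] ℝ))) ≃L[ℝ] (E × E) × (E × E →L[ℝ] ℝ) :=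
  (ContinuousLinearEquiv.prodProdProdComm ℝ E (E →L[ℝ] ℝ) E (E →L[ℝ] ℝ)).trans
    ((ContinuousLinearEquiv.refl ℝ (E × E)).prodCongr
      ((ContinuousLinearEquiv.prodComm ℝ (E →L[ℝ] ℝ) (E →L[ℝ] ℝ)).trans
        (ContinuousLinearMap.coprodEquivL ℝ)))

variable (E) in
/-- The map `((q₀, p₀), (q₁, p₁)) ↦ ((q₀, q₁), (-p₀, p₁))`, i.e. `Φ` in induced coordinates. -/
def phiModel :
    ((E × (E →L[ℝ] ℝ)) × (E × (E →L[ℝ] ℝ))) ≃L[ℝ] (E × E) × (E × E →L[ℝ] ℝ) :=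
  (ContinuousLinearEquiv.prodProdProdComm ℝ E (E →L[ℝ] ℝ) E (E →L[ℝ] ℝ)).trans
    ((ContinuousLinearEquiv.refl ℝ (E × E)).prodCongr
      (((ContinuousLinearEquiv.neg ℝ).prodCongr (ContinuousLinearEquiv.refl ℝ (E →L[ℝ] ℝ))).trans
        (ContinuousLinearMap.coprodEquivL ℝ)))

theorem linearOneForm_tangentBilin_liouvilleBilin_apply (z : (E × (E →L[ℝ] ℝ)) × E × (E →L[ℝ] ℝ))
    (X : Fin 1 → (E × (E →L[ℝ] ℝ)) × E × (E →L[ℝ] ℝ)) :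
    linearOneForm (tangentBilin (liouvilleBilin E)) z X =
      (tulczyjewModel E z).2 ((X 0).1.1, (X 0).2.1) := rfl

theorem skewForm_canonicalBilin_comp_tulczyjewModel :
    (skewForm (canonicalBilin (E × E))).compContinuousLinearMap
      (tulczyjewModel E : _ →L[ℝ] (E × E) × (E × E →L[ℝ] ℝ)) =
      skewForm (tangentBilin (canonicalBilin E)) := by
  refine skewForm_compContinuousLinearMap fun v w => ?_
  rw [canonicalBilin_apply, tangentBilin_apply, canonicalBilin_apply, canonicalBilin_apply]
  exact neg_add (v.2.2 w.1.1) (v.1.2 w.2.1)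

theorem skewForm_diffBilin_comp_phiModel_symm :
    (skewForm (diffBilin (canonicalBilin E))).compContinuousLinearMap
      ((phiModel E).symm : (E × E) × (E × E →L[ℝ] ℝ) →L[ℝ] _) =
      skewForm (canonicalBilin (E × E)) := by
  refine skewForm_compContinuousLinearMap fun v w => ?_
  obtain ⟨v, rfl⟩ := (phiModel E).surjective v
  obtain ⟨w, rfl⟩ := (phiModel E).surjective w
  rw [ContinuousLinearEquiv.coe_coe, ContinuousLinearEquiv.symm_apply_apply,
    ContinuousLinearEquiv.symm_apply_apply, canonicalBilin_apply, diffBilin_apply,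
    canonicalBilin_apply, canonicalBilin_apply]
  change _ = -(-v.1.2 w.1.1 + v.2.2 w.2.1)
  ring

section Tulczyjew

variable (I M) in
/-- Tulczyjew's map as a bijection; its inverse is `(q, q̇, a, b) ↦ (q, b, q̇, a)` in induced
coordinates. -/
def tulczyjewEquiv :
    TangentBundle I.cotangent (CotangentBundle I M) ≃
      CotangentBundle I.tangent (TangentBundle I M) where
  toFun := tulczyjewAlpha I
  invFun γ := ⟨⟨γ.proj.proj, γ.covec ∘L ContinuousLinearMap.inr ℝ E E⟩,
    (tangentVec γ.proj, γ.covec ∘L ContinuousLinearMap.inl ℝ E E)⟩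
  left_inv v := tangentBundle_ext
    (CotangentBundle.ext rfl (ContinuousLinearMap.coprod_comp_inr (tangentVec v).2 v.proj.covec))
    (Prod.ext rfl (ContinuousLinearMap.coprod_comp_inl (tangentVec v).2 v.proj.covec))
  right_inv γ := CotangentBundle.ext rfl γ.covec.coprod_comp_inl_inr

variable [I.Boundaryless]

theorem proj_tulczyjewAlpha (v : TangentBundle I.cotangent (CotangentBundle I M)) :
    (tulczyjewAlpha I v).proj = tangentMap I.cotangent I (cotangentProj I) v :=
  tangentBundle_ext rfl
    (DFunLike.congr_fun ((IsLinearInCharts.totalSpaceProj (I := I)).tderiv_eq v.proj)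
      (tangentVec v)).symm

theorem coef_dT_liouvilleForm_apply (v : TangentBundle I.cotangent (CotangentBundle I M))
    (X : Fin 1 → (E × (E →L[ℝ] ℝ)) × (E × (E →L[ℝ] ℝ))) :
    DiffForm.coef (DiffForm.dT I.cotangent (liouvilleForm I M)) v X =
      (tulczyjewAlpha I v).covec ((X 0).1.1, (X 0).2.1) := by
  rw [(DiffForm.hasChartExpr_dT_liouvilleForm v).coef_self,
    linearOneForm_tangentBilin_liouvilleBilin_apply,
    extChartAt_tangentBundle (mem_extChartAt_source (I := I.cotangent) v.proj),
    tderiv_extChartAt_self,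
    CotangentBundle.extChartAt_eq (mem_extChartAt_source v.proj.proj), tderiv_extChartAt_symm_self]
  rfl

theorem isLinearInCharts_tulczyjewAlpha :
    IsLinearInCharts I.cotangent.tangent I.tangent.cotangent (tulczyjewEquiv I M)
      (tulczyjewModel E : _ →L[ℝ] (E × E) × (E × E →L[ℝ] ℝ)) := by
  have hproj : IsLinearInCharts I.cotangent.tangent I.tangent
      (fun v : TangentBundle I.cotangent (CotangentBundle I M) => (tulczyjewAlpha I v).proj)
      ((ContinuousLinearMap.fst ℝ E (E →L[ℝ] ℝ)).prodMap
        (ContinuousLinearMap.fst ℝ E (E →L[ℝ] ℝ))) := by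
    simp only [proj_tulczyjewAlpha]
    exact IsLinearInCharts.totalSpaceProj.tangentMap
  intro v₀ v hv
  have hsource := (hproj v₀ v hv).1
  refine ⟨CotangentBundle.mem_extChartAt_source.2 hsource, ?_⟩
  suffices hc : (tulczyjewModel E (extChartAt I.cotangent.tangent v₀ v)).2 ∘L
      tderiv I.tangent 𝓘(ℝ, E × E) (extChartAt I.tangent (tulczyjewAlpha I v₀).proj)
        (tulczyjewAlpha I v).proj = (tulczyjewAlpha I v).covec from
    (CotangentBundle.extChartAt_eq_of_comp_eq hsource hc).trans
      (Prod.ext (hproj v₀ v hv).2 rfl)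
  refine ContinuousLinearMap.ext fun u => ?_
  have h := coef_dT_liouvilleForm_apply v fun _ => ((u.1, 0), (u.2, 0))
  rw [(DiffForm.hasChartExpr_dT_liouvilleForm v₀).coef_eq hv,
    ContinuousAlternatingMap.compContinuousLinearMap_apply,
    linearOneForm_tangentBilin_liouvilleBilin_apply] at h
  refine (congrArg (tulczyjewModel E (extChartAt I.cotangent.tangent v₀ v)).2 ?_).trans h
  exact DFunLike.congr_fun (hproj.tderiv_extChartAt_comp hv) ((u.1, 0), (u.2, 0))

theorem isSymplectoOn_tulczyjewAlpha {V : Set (TangentBundle I M)} (hV : IsOpen V) :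
    IsSymplectoOn I.cotangent.tangent I.tangent.cotangent
      (DiffForm.dT I.cotangent (canonicalForm I M)) (canonicalForm I.tangent (TangentBundle I M))
      (tulczyjewAlpha I) (tangentMap I.cotangent I (cotangentProj I) ⁻¹' V)
      (cotangentProj I.tangent ⁻¹' V) := by
  have hsymm := isLinearInCharts_tulczyjewAlpha (I := I) (M := M).symm fun v₀ v hv =>
    mem_extChartAt_tangentBundle_source.2 (CotangentBundle.mem_extChartAt_source.2
      (mem_extChartAt_tangentBundle_source.1 (CotangentBundle.mem_extChartAt_source.1 hv)))
  have hpreimage : tangentMap I.cotangent I (cotangentProj I) ⁻¹' V =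
      tulczyjewEquiv I M ⁻¹' (cotangentProj I.tangent ⁻¹' V) := by
    ext v
    exact iff_of_eq (congrArg (· ∈ V) (proj_tulczyjewAlpha v).symm)
  rw [hpreimage]
  exact isSymplectoOn_of_isLinearInCharts isLinearInCharts_tulczyjewAlpha hsymm
    DiffForm.hasChartExpr_dT_canonicalForm DiffForm.hasChartExpr_canonicalForm
    skewForm_canonicalBilin_comp_tulczyjewModel
    (hV.preimage (FiberBundle.continuous_proj _ _))

end Tulczyjew

section Phi

variable [I.Boundaryless]

theorem tderiv_extChartAt_prod_apply {E' : Type*} [NormedAddCommGroup E'] [NormedSpace ℝ E']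
    {H' : Type*} [TopologicalSpace H'] {J : ModelWithCorners ℝ E' H'} [J.Boundaryless]
    {N : Type*} [TopologicalSpace N] [ChartedSpace H' N] [IsManifold J ∞ N] {z₀ z : M × N}
    (hz : z ∈ (extChartAt (I.prod J) z₀).source) (u : E × E') :
    tderiv (I.prod J) 𝓘(ℝ, E × E') (extChartAt (I.prod J) z₀) z u =
      (tderiv I 𝓘(ℝ, E) (extChartAt I z₀.1) z.1 u.1,
        tderiv J 𝓘(ℝ, E') (extChartAt J z₀.2) z.2 u.2) :=
  Prod.ext (DFunLike.congr_fun ((IsLinearInCharts.fst I J).tderiv_extChartAt_comp hz) u).symm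
    (DFunLike.congr_fun ((IsLinearInCharts.snd I J).tderiv_extChartAt_comp hz) u).symm

theorem isLinearInCharts_cotangentPhi :
    IsLinearInCharts (I.cotangent.prod I.cotangent) (I.prod I).cotangent
      (cotangentPhi I (M := M)) (phiModel E : _ →L[ℝ] (E × E) × (E × E →L[ℝ] ℝ)) := by
  intro a₀ a ha
  obtain ⟨ha₁, hchart₁⟩ := IsLinearInCharts.fst I.cotangent I.cotangent a₀ a ha
  obtain ⟨ha₂, hchart₂⟩ := IsLinearInCharts.snd I.cotangent I.cotangent a₀ a ha
  have hproj₁ := CotangentBundle.mem_extChartAt_source.1 ha₁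
  have hproj₂ := CotangentBundle.mem_extChartAt_source.1 ha₂
  have hsource : (cotangentPhi I a).proj ∈
      (extChartAt (I.prod I) (cotangentPhi I a₀).proj).source := by
    rw [extChartAt_prod]
    exact ⟨hproj₁, hproj₂⟩
  have hbase : extChartAt (I.prod I) (cotangentPhi I a₀).proj (cotangentPhi I a).proj =
      ((extChartAt I.cotangent a₀.1 a.1).1, (extChartAt I.cotangent a₀.2 a.2).1) :=
    Prod.ext
      ((IsLinearInCharts.fst I I _ _ hsource).2.symm.trans
        (IsLinearInCharts.totalSpaceProj _ _ ha₁).2)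
      ((IsLinearInCharts.snd I I _ _ hsource).2.symm.trans
        (IsLinearInCharts.totalSpaceProj _ _ ha₂).2)
  have hcovec : (-(extChartAt I.cotangent a₀.1 a.1).2).coprod (extChartAt I.cotangent a₀.2 a.2).2 ∘L
      tderiv (I.prod I) 𝓘(ℝ, E × E) (extChartAt (I.prod I) (cotangentPhi I a₀).proj)
        (cotangentPhi I a).proj = (cotangentPhi I a).covec := by
    refine ContinuousLinearMap.ext fun u => ?_
    rw [ContinuousLinearMap.comp_apply, tderiv_extChartAt_prod_apply hsource]
    exact congrArg₂ (fun s t : ℝ => -s + t)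
      (DFunLike.congr_fun (CotangentBundle.extChartAt_snd_comp hproj₁) u.1)
      (DFunLike.congr_fun (CotangentBundle.extChartAt_snd_comp hproj₂) u.2)
  refine ⟨CotangentBundle.mem_extChartAt_source.2 hsource, ?_⟩
  rw [CotangentBundle.extChartAt_eq_of_comp_eq hsource hcovec, hbase, hchart₁, hchart₂]
  rfl

theorem isSymplectoOn_cotangentPhi_symm {B : Set (M × M)} (hB : IsOpen B) :
    IsSymplectoOn (I.prod I).cotangent (I.cotangent.prod I.cotangent)
      (canonicalForm (I.prod I) (M × M)) (omega12 I M) (cotangentPhi I).symm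
      (cotangentProj (I.prod I) ⁻¹' B)
      (Prod.map (cotangentProj I) (cotangentProj I) ⁻¹' B) := by
  have hsymm := isLinearInCharts_cotangentPhi (I := I) (M := M).symm fun a₀ a ha => by
    have h := CotangentBundle.mem_extChartAt_source.1 ha
    rw [extChartAt_prod] at h ⊢
    exact ⟨CotangentBundle.mem_extChartAt_source.2 h.1, CotangentBundle.mem_extChartAt_source.2 h.2⟩
  exact isSymplectoOn_of_isLinearInCharts hsymm isLinearInCharts_cotangentPhi
    DiffForm.hasChartExpr_canonicalForm DiffForm.hasChartExpr_omega12
    skewForm_diffBilin_comp_phiModel_symm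
    (hB.preimage ((FiberBundle.continuous_proj _ _).prodMap (FiberBundle.continuous_proj _ _)))

end Phi

end LinearLifts

section CotangentLift

variable {E : Type*} [NormedAddCommGroup E] [NormedSpace ℝ E]
  {H : Type*} [TopologicalSpace H] {I : ModelWithCorners ℝ E H}
  {M : Type*} [TopologicalSpace M] [ChartedSpace H M]
  {E' : Type*} [NormedAddCommGroup E'] [NormedSpace ℝ E']
  {H' : Type*} [TopologicalSpace H'] {J : ModelWithCorners ℝ E' H'}
  {N : Type*} [TopologicalSpace N] [ChartedSpace H' N]
  {F : M → N} {G : N → M} {A : Set M} {B : Set N}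

theorem covec_cotangentHat (hF : IsDiffeoOn I J F A B) (hG : IsDiffeoOn J I G B A)
    (hinv : InvOn G F A B) {α : CotangentBundle I M} (hα : α.proj ∈ A) :
    (cotangentHat I J F α).covec = α.covec ∘L tderiv J I G (F α.proj) := by
  rw [← hF.inverse_tderiv hG hinv hα]
  rfl

theorem leftInvOn_cotangentHat (hF : IsDiffeoOn I J F A B) (hG : IsDiffeoOn J I G B A)
    (hinv : InvOn G F A B) :
    LeftInvOn (cotangentHat J I G) (cotangentHat I J F) (cotangentProj I ⁻¹' A) := by
  intro α hα
  refine CotangentBundle.ext (hinv.1 hα) ?_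
  rw [covec_cotangentHat hG hF hinv.symm (hF.2.2.1.mapsTo hα), covec_cotangentHat hF hG hinv hα]
  change (α.covec ∘L tderiv J I G (F α.proj)) ∘L tderiv I J F (G (F α.proj)) = α.covec
  rw [hinv.1 hα, ContinuousLinearMap.comp_assoc, hF.tderiv_comp_tderiv hG hinv.1 hα,
    ContinuousLinearMap.comp_id]

variable [I.Boundaryless] [IsManifold I ∞ M] [J.Boundaryless] [IsManifold J ∞ N]

theorem contMDiffAt_cotangentHat (hF : IsDiffeoOn I J F A B) {α₀ : CotangentBundle I M}
    (hα₀ : α₀.proj ∈ A) :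
    ContMDiffAt I.cotangent J.cotangent ∞ (cotangentHat I J F) α₀ := by
  obtain ⟨G, hG, hinv⟩ := hF.exists_inverse
  have hFα₀ := hF.2.2.1.mapsTo hα₀
  have hproj : ContMDiffAt I.cotangent J ∞ (fun α : CotangentBundle I M => F α.proj) α₀ :=
    (hF.contMDiffAt hα₀).comp α₀ IsLinearInCharts.totalSpaceProj.contMDiff.contMDiffAt
  have hfderiv : ContMDiffAt I.cotangent 𝓘(ℝ, E' →L[ℝ] E) ∞
      (fun α => fderiv ℝ (writtenInExtChartAt J I (F α₀.proj) G)
        (extChartAt J (F α₀.proj) (F α.proj))) α₀ :=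
    (((contDiffAt_writtenInExtChartAt (hG.contMDiffAt hFα₀)).fderiv_right
      le_rfl).contMDiffAt).comp α₀ (contMDiffAt_extChartAt.comp α₀ hproj)
  have hcovec : ContMDiffAt I.cotangent 𝓘(ℝ, E →L[ℝ] ℝ) ∞
      (fun α => (extChartAt I.cotangent α₀ α).2) α₀ :=
    contDiff_snd.contMDiff.contMDiffAt.comp α₀ contMDiffAt_extChartAt
  refine CotangentBundle.contMDiffAt_of_coordinates hproj (hcovec.clm_comp hfderiv) ?_
  have hprojA : ∀ᶠ α in 𝓝 α₀, α.proj ∈ A ∩ (extChartAt I α₀.proj).source :=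
    (FiberBundle.continuous_proj _ _).continuousAt.eventually
      (Filter.inter_mem (hF.1.mem_nhds hα₀) (extChartAt_source_mem_nhds α₀.proj))
  filter_upwards [hprojA, hproj.continuousAt.preimage_mem_nhds
    (extChartAt_source_mem_nhds (I := J) (F α₀.proj))] with α ⟨hαA, hα⟩ hFα
  have hderiv := fderiv_writtenInExtChartAt (f := G) hFα
    (by rwa [hinv.1 hα₀, hinv.1 hαA]) (hG.mdifferentiableAt (hF.2.2.1.mapsTo hαA))
  rw [hinv.1 hα₀, hinv.1 hαA] at hderiv
  rw [hderiv, covec_cotangentHat hF hG hinv hαA, ← CotangentBundle.extChartAt_snd_comp hα]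
  refine ContinuousLinearMap.ext fun u => ?_
  exact congrArg (((extChartAt I.cotangent α₀ α).2 ∘L
    tderiv I 𝓘(ℝ, E) (extChartAt I α₀.proj) α.proj) ∘L tderiv J I G (F α.proj))
    (DFunLike.congr_fun (tderiv_extChartAt_symm_comp hFα) u)

theorem pullback_cotangentHat_liouvilleForm (hF : IsDiffeoOn I J F A B) {α : CotangentBundle I M}
    (hα : α.proj ∈ A) :
    DiffForm.pullback I.cotangent J.cotangent (cotangentHat I J F) (liouvilleForm J N) α =
      liouvilleForm I M α := by
  obtain ⟨G, hG, hinv⟩ := hF.exists_inverse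
  have hπM := IsLinearInCharts.totalSpaceProj (I := I) (F := E →L[ℝ] ℝ)
    (V := fun x : M => TangentSpace I x →L[ℝ] Trivial M ℝ x)
  have hπN := IsLinearInCharts.totalSpaceProj (I := J) (F := E' →L[ℝ] ℝ)
    (V := fun y : N => TangentSpace J y →L[ℝ] Trivial N ℝ y)
  have hproj : ContinuousLinearMap.fst ℝ E' (E' →L[ℝ] ℝ) ∘L
      tderiv I.cotangent J.cotangent (cotangentHat I J F) α =
        tderiv I J F α.proj ∘L ContinuousLinearMap.fst ℝ E (E →L[ℝ] ℝ) := by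
    have hhat := (contMDiffAt_cotangentHat hF hα).mdifferentiableAt (by simp)
    rw [← hπN.tderiv_eq (cotangentHat I J F α), ← hπM.tderiv_eq α,
      ← tderiv_comp α (hπN.mdifferentiableAt _) hhat,
      ← tderiv_comp α (hF.mdifferentiableAt hα) (hπM.mdifferentiableAt _)]
    rfl
  apply DiffForm.ext_coef
  ext X
  rw [DiffForm.coef_pullback, ContinuousAlternatingMap.compContinuousLinearMap_apply,
    DiffForm.coef_liouvilleForm_apply, DiffForm.coef_liouvilleForm_apply,
    covec_cotangentHat hF hG hinv hα]
  refine congrArg (fun T => α.covec (tderiv J I G (F α.proj) (T (X 0)))) hproj |>.trans ?_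
  exact congrArg α.covec (DFunLike.congr_fun (hF.tderiv_comp_tderiv hG hinv.1 hα) (X 0).1)

theorem pullback_cotangentHat_canonicalForm (hF : IsDiffeoOn I J F A B) {α : CotangentBundle I M}
    (hα : α.proj ∈ A) :
    DiffForm.pullback I.cotangent J.cotangent (cotangentHat I J F) (canonicalForm J N) α =
      canonicalForm I M α := by
  have hd := DiffForm.d_pullback (contMDiffAt_cotangentHat hF hα)
    ((DiffForm.hasChartExpr_liouvilleForm (cotangentHat I J F α)).differentiableAt_inChart
      (linearOneForm (liouvilleBilin E')).differentiable)
  have hθ : DiffForm.d I.cotangent (DiffForm.pullback I.cotangent J.cotangent (cotangentHat I J F)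
      (liouvilleForm J N)) α = DiffForm.d I.cotangent (liouvilleForm I M) α :=
    DiffForm.d_congr <| by
      filter_upwards [(FiberBundle.continuous_proj _ _).continuousAt.preimage_mem_nhds
        (hF.1.mem_nhds hα)] with β hβ using pullback_cotangentHat_liouvilleForm hF hβ
  exact congrArg Neg.neg (hd.symm.trans hθ)

theorem isSymplectoOn_cotangentHat (hF : IsDiffeoOn I J F A B) :
    IsSymplectoOn I.cotangent J.cotangent (canonicalForm I M) (canonicalForm J N)
      (cotangentHat I J F) (cotangentProj I ⁻¹' A) (cotangentProj J ⁻¹' B) := by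
  obtain ⟨G, hG, hinv⟩ := hF.exists_inverse
  have hhatinv : InvOn (cotangentHat J I G) (cotangentHat I J F) (cotangentProj I ⁻¹' A)
      (cotangentProj J ⁻¹' B) :=
    ⟨leftInvOn_cotangentHat hF hG hinv, leftInvOn_cotangentHat hG hF hinv.symm⟩
  refine ⟨⟨hF.1.preimage (FiberBundle.continuous_proj _ _),
    hF.2.1.preimage (FiberBundle.continuous_proj _ _),
    hhatinv.bijOn (fun α hα => hF.2.2.1.mapsTo hα) fun β hβ => hG.2.2.1.mapsTo hβ,
    fun α hα => (contMDiffAt_cotangentHat hF hα).contMDiffWithinAt, cotangentHat J I G, hhatinv.1,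
    fun β hβ => (contMDiffAt_cotangentHat hG hβ).contMDiffWithinAt⟩, fun α hα =>
    pullback_cotangentHat_canonicalForm hF hα⟩

theorem isSymplectoOn_cotangentLift {R : TangentBundle I M → M × M} {V : Set (TangentBundle I M)}
    {W : Set (M × M)} (hR : IsDiffeoOn I.tangent (I.prod I) R V W) :
    IsSymplectoOn I.cotangent.tangent (I.cotangent.prod I.cotangent)
      (DiffForm.dT I.cotangent (canonicalForm I M)) (omega12 I M) (cotangentLift I R)
      (tangentMap I.cotangent I (cotangentProj I) ⁻¹' V)
      (Prod.map (cotangentProj I) (cotangentProj I) ⁻¹' W) :=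
  (isSymplectoOn_cotangentPhi_symm hR.2.1).comp
    ((isSymplectoOn_cotangentHat hR).comp (isSymplectoOn_tulczyjewAlpha hR.1))

end CotangentLift

section InverseFunctionTheorem

variable {E : Type*} [NormedAddCommGroup E] [NormedSpace ℝ E]
  {H : Type*} [TopologicalSpace H] {I : ModelWithCorners ℝ E H}
  {M : Type*} [TopologicalSpace M] [ChartedSpace H M]
  {E' : Type*} [NormedAddCommGroup E'] [NormedSpace ℝ E']
  {H' : Type*} [TopologicalSpace H'] {J : ModelWithCorners ℝ E' H'}
  {N : Type*} [TopologicalSpace N] [ChartedSpace H' N]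
  {n : WithTop ℕ∞} {f : M → N} {x : M}

theorem isLocalDiffeomorphAt_of_eventuallyEq {e : OpenPartialHomeomorph M N} (hx : x ∈ e.source)
    (hfe : f =ᶠ[𝓝 x] e)
    (he : ∀ᶠ y in 𝓝 x, ContMDiffAt I J n e y ∧ ContMDiffAt J I n e.symm (e y)) :
    IsLocalDiffeomorphAt I J n f x := by
  obtain ⟨s, hs, hs_open, hxs⟩ := eventually_nhds_iff.1 (hfe.and he)
  let e' := e.restrOpen s hs_open
  have hsource {y : M} (hy : y ∈ e'.source) : y ∈ s := hy.2
  refine ⟨⟨e'.toPartialEquiv, e'.open_source, e'.open_target, fun y hy => ?_, fun y hy => ?_⟩,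
    ⟨hx, hxs⟩, fun y hy => (hs y (hsource hy)).1⟩
  · exact (hs y (hsource hy)).2.1.contMDiffWithinAt
  · have h := (hs (e.symm y) (hsource (e'.map_target hy))).2.2
    rw [show e (e.symm y) = y from e'.right_inv hy] at h
    exact h.contMDiffWithinAt

theorem isLocalDiffeomorphAt_congr {g : M → N} (hf : IsLocalDiffeomorphAt I J n f x)
    (hfg : g =ᶠ[𝓝 x] f) : IsLocalDiffeomorphAt I J n g x := by
  obtain ⟨Φ, hx, hΦ⟩ := hf
  have hΦx := Φ.open_source.mem_nhds hx
  refine isLocalDiffeomorphAt_of_eventuallyEq (e := Φ.toOpenPartialHomeomorph) hx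
    (hfg.trans (Filter.eventuallyEq_of_mem hΦx hΦ)) ?_
  filter_upwards [hΦx] with y hy
  exact ⟨Φ.contMDiffOn_toFun.contMDiffAt (Φ.open_source.mem_nhds hy),
    Φ.contMDiffOn_invFun.contMDiffAt (Φ.open_target.mem_nhds (Φ.map_source hy))⟩

theorem isOpen_setOf_isLocalDiffeomorphAt (f : M → N) :
    IsOpen {x | IsLocalDiffeomorphAt I J n f x} := by
  refine isOpen_iff_mem_nhds.2 fun x ⟨Φ, hx, hΦ⟩ => ?_
  filter_upwards [Φ.open_source.mem_nhds hx] with y hy using ⟨Φ, hy, hΦ⟩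

theorem exists_mem_nhds_injOn_of_isLocalDiffeomorphAt (hf : IsLocalDiffeomorphAt I J n f x) :
    ∃ u ∈ 𝓝 x, InjOn f u := by
  obtain ⟨Φ, hx, hΦ⟩ := hf
  exact ⟨Φ.source, Φ.open_source.mem_nhds hx, Φ.injOn.congr hΦ.symm⟩

theorem isDiffeoOn_image_of_injOn [Nonempty (N → M)] {A : Set M} (hA : IsOpen A)
    (hf : IsLocalDiffeomorphOn I J ∞ f A) (hinj : InjOn f A) : IsDiffeoOn I J f A (f '' A) := by
  obtain ⟨g, hg⟩ : ∃ g : N → M, LeftInvOn g f A := by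
    cases isEmpty_or_nonempty M
    · exact ⟨Classical.arbitrary (N → M), fun x => isEmptyElim x⟩
    · exact ⟨Function.invFunOn f A, hinj.leftInvOn_invFunOn⟩
  refine ⟨hA, ?_, hinj.bijOn_image, hf.contMDiffOn, g, hg, ?_⟩
  · refine isOpen_iff_mem_nhds.2 (forall_mem_image.2 fun x hx => ?_)
    rw [← hf.isLocalHomeomorphOn.map_nhds_eq hx]
    exact Filter.image_mem_map (hA.mem_nhds hx)
  · refine forall_mem_image.2 fun x hx => ContMDiffAt.contMDiffWithinAt ?_
    have hloc := hf ⟨x, hx⟩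
    have hcont : Filter.Tendsto hloc.localInverse (𝓝 (f x)) (𝓝 x) := by
      have h := hloc.localInverse_contMDiffAt.continuousAt
      rwa [ContinuousAt, hloc.localInverse_left_inv hloc.localInverse_mem_target] at h
    refine hloc.localInverse_contMDiffAt.congr_of_eventuallyEq ?_
    filter_upwards [hloc.localInverse_eventuallyEq_right, hcont.eventually (hA.mem_nhds hx)]
      with y hy hyA
    exact (congrArg g hy).symm.trans (hg hyA)

theorem isLocalDiffeomorphAt_of_isInvertible_fderiv [CompleteSpace E] {f : E → E'} {x : E}
    (hf : ∀ᶠ y in 𝓝 x, ContDiffAt ℝ n f y) (hn : n ≠ 0) (hd : (fderiv ℝ f x).IsInvertible) :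
    IsLocalDiffeomorphAt 𝓘(ℝ, E) 𝓘(ℝ, E') n f x := by
  have hfx := hf.self_of_nhds
  obtain ⟨A, hA⟩ := hd
  have hfA : HasFDerivAt f (A : E →L[ℝ] E') x := hA ▸ (hfx.differentiableAt hn).hasFDerivAt
  let e := hfx.toOpenPartialHomeomorph f hfA hn
  have hex : x ∈ e.source := hfx.mem_toOpenPartialHomeomorph_source hfA hn
  have hinv : ∀ᶠ y in 𝓝 x, (fderiv ℝ f y).IsInvertible :=
    (hfx.continuousAt_fderiv hn).eventually (hA ▸ A.nhds)
  refine isLocalDiffeomorphAt_of_eventuallyEq hex (Filter.EventuallyEq.refl _ _) ?_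
  filter_upwards [hf, hinv, e.open_source.mem_nhds hex] with y hy ⟨B, hB⟩ hye
  refine ⟨hy.contMDiffAt, (e.contDiffAt_symm (f₀' := B) (e.map_source hye) ?_ ?_).contMDiffAt⟩
  · rw [e.left_inv hye, hB]
    exact (hy.differentiableAt hn).hasFDerivAt
  · rwa [e.left_inv hye]

variable [I.Boundaryless]

theorem eventually_contDiffAt_writtenInExtChartAt [IsManifold I n M] [IsManifold J n N]
    (hf : ∀ᶠ y in 𝓝 x, ContMDiffAt I J n f y) :
    ∀ᶠ z in 𝓝 (extChartAt I x x), ContDiffAt ℝ n (writtenInExtChartAt I J x f) z := by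
  have hsource : ∀ᶠ y in 𝓝 x, f y ∈ (chartAt H' (f x)).source :=
    hf.self_of_nhds.continuousAt.eventually (chart_source_mem_nhds H' (f x))
  filter_upwards [(tendsto_extChartAt_symm (I := I) x).eventually (hf.and hsource),
    extChartAt_target_mem_nhds x] with z ⟨hfz, hz⟩ hzt
  exact ((contMDiffAt_extChartAt' hz).comp z
    (hfz.comp z (contMDiffAt_extChartAt_symm hzt))).contDiffAt

/-- A chart, as a diffeomorphism between open sets. -/
def extChartAtPartialDiffeomorph [IsManifold I n M] (x : M) :
    PartialDiffeomorph I 𝓘(ℝ, E) M E n where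
  toPartialEquiv := extChartAt I x
  open_source := isOpen_extChartAt_source x
  open_target := isOpen_extChartAt_target x
  contMDiffOn_toFun := by
    rw [extChartAt_source]
    exact contMDiffOn_extChartAt
  contMDiffOn_invFun := contMDiffOn_extChartAt_symm x

theorem isLocalDiffeomorphAt_of_isInvertible_tderiv [J.Boundaryless] [CompleteSpace E]
    [IsManifold I n M] [IsManifold J n N] (hf : ∀ᶠ y in 𝓝 x, ContMDiffAt I J n f y) (hn : n ≠ 0)
    (hd : (tderiv I J f x).IsInvertible) : IsLocalDiffeomorphAt I J n f x := by
  have := IsManifold.of_le (I := I) (M := M) (ENat.one_le_iff_ne_zero_withTop.2 hn)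
  have := IsManifold.of_le (I := J) (M := N) (ENat.one_le_iff_ne_zero_withTop.2 hn)
  set φ : PartialDiffeomorph I 𝓘(ℝ, E) M E n := extChartAtPartialDiffeomorph x
  set ψ : PartialDiffeomorph J 𝓘(ℝ, E') N E' n := extChartAtPartialDiffeomorph (f x)
  set F := writtenInExtChartAt I J x f
  have hFx : F (φ x) = ψ (f x) := congrArg (fun y => ψ (f y)) (φ.left_inv (mem_extChartAt_source x))
  have hφ : IsLocalDiffeomorphAt I 𝓘(ℝ, E) n φ x :=
    φ.isLocalDiffeomorphAt _ _ _ (mem_extChartAt_source x)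
  have hF : IsLocalDiffeomorphAt 𝓘(ℝ, E) 𝓘(ℝ, E') n F (φ x) :=
    isLocalDiffeomorphAt_of_isInvertible_fderiv (eventually_contDiffAt_writtenInExtChartAt hf) hn
      ((fderiv_writtenInExtChartAt_self (hf.self_of_nhds.mdifferentiableAt hn)).symm ▸ hd)
  have hψ : IsLocalDiffeomorphAt 𝓘(ℝ, E') J n ψ.symm (F (φ x)) :=
    ψ.symm.isLocalDiffeomorphAt _ _ _ (hFx ▸ mem_extChartAt_target (f x))
  refine isLocalDiffeomorphAt_congr ((hφ.comp _ _ hF).comp _ _ hψ) ?_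
  filter_upwards [extChartAt_source_mem_nhds (I := I) x, hf.self_of_nhds.continuousAt.eventually
    (extChartAt_source_mem_nhds (I := J) (f x))] with y hy hfy
  change f y = ψ.symm (ψ (f (φ.symm (φ y))))
  exact (φ.left_inv hy).symm ▸ (ψ.left_inv hfy).symm

end InverseFunctionTheorem

section Discretization

theorem exists_isOpen_injOn_of_section {X Y B : Type*} [TopologicalSpace X] [TopologicalSpace B]
    [TopologicalSpace.MetrizableSpace X] {f : X → Y} {p : Y → B} {z : B → X}
    (hz : Continuous z) (hpz : ∀ b, p (f (z b)) = b) (hpf : ∀ b, ContinuousAt (p ∘ f) (z b))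
    (hloc : ∀ b, ∃ u ∈ 𝓝 (z b), InjOn f u) :
    ∃ V : Set X, IsOpen V ∧ (∀ b, z b ∈ V) ∧ InjOn f V := by
  let := TopologicalSpace.metrizableSpaceMetric X
  -- Two points of `W` with the same value under `f` lie in balls around the same point of the
  -- section, and `f` is injective on the larger ball.
  let W : Set X := {ξ | ∃ r, dist ξ (z (p (f ξ))) < r ∧ InjOn f (Metric.ball (z (p (f ξ))) r)}
  refine ⟨interior W, isOpen_interior, fun b => ?_, InjOn.mono interior_subset ?_⟩
  · obtain ⟨u, hu, hfu⟩ := hloc b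
    obtain ⟨r, hr, hru⟩ := Metric.mem_nhds_iff.1 hu
    have hcont : Filter.Tendsto (fun ξ => z (p (f ξ))) (𝓝 (z b)) (𝓝 (z b)) := by
      have h : ContinuousAt (z ∘ p ∘ f) (z b) := hz.continuousAt.comp (hpf b)
      rwa [ContinuousAt, Function.comp_apply, Function.comp_apply, hpz] at h
    have hball : Metric.ball (z b) (r / 4) ∈ 𝓝 (z b) := Metric.ball_mem_nhds _ (by positivity)
    refine mem_interior_iff_mem_nhds.2 ?_
    filter_upwards [hball, hcont hball] with ξ hξ hzξ
    refine ⟨r / 2, ?_, hfu.mono ((Metric.ball_subset_ball' ?_).trans hru)⟩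
    · linarith [dist_triangle_right ξ (z (p (f ξ))) (z b), Metric.mem_ball.1 hξ,
        Metric.mem_ball.1 hzξ]
    · linarith [Metric.mem_ball.1 hzξ]
  · rintro ξ ⟨r, hr, hfr⟩ η ⟨s, hs, hfs⟩ h
    rw [← h] at hs hfs
    rcases le_total r s with hrs | hrs
    · exact hfs (hr.trans_le hrs) hs h
    · exact hfr hr (hs.trans_le hrs) h

variable {E : Type*} [NormedAddCommGroup E] [NormedSpace ℝ E]
  {H : Type*} [TopologicalSpace H] {I : ModelWithCorners ℝ E H}
  {Q : Type*} [TopologicalSpace Q] [ChartedSpace H Q]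

theorem isInvertible_of_sub_eq_id {A B : E →L[ℝ] E} (h : B - A = ContinuousLinearMap.id ℝ E) :
    ((ContinuousLinearMap.fst ℝ E E + A ∘L ContinuousLinearMap.snd ℝ E E).prod
      (ContinuousLinearMap.fst ℝ E E + B ∘L ContinuousLinearMap.snd ℝ E E)).IsInvertible := by
  obtain rfl : B = A + ContinuousLinearMap.id ℝ E := by rw [← h, add_sub_cancel]
  let δ := ContinuousLinearMap.snd ℝ E E - ContinuousLinearMap.fst ℝ E E
  refine .of_inverse (g := (ContinuousLinearMap.fst ℝ E E - A ∘L δ).prod δ) ?_ ?_ <;>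
    ext <;> simp [δ]

variable [IsManifold I ∞ Q]

theorem extChartAt_symm_fiber (x : Q) (v : E) :
    (extChartAt I.tangent (⟨x, 0⟩ : TangentBundle I Q)).symm (extChartAt I x x, v) = ⟨x, v⟩ := by
  have hx : x ∈ (extChartAt I x).source := mem_extChartAt_source x
  have h : extChartAt I.tangent (⟨x, 0⟩ : TangentBundle I Q) ⟨x, v⟩ = (extChartAt I x x, v) := by
    rw [extChartAt_tangentBundle (v₀ := (⟨x, 0⟩ : TangentBundle I Q))
      (v := (⟨x, v⟩ : TangentBundle I Q)) hx, tderiv_extChartAt_self]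
    rfl
  rw [← h]
  exact (extChartAt I.tangent (⟨x, 0⟩ : TangentBundle I Q)).left_inv
    (mem_extChartAt_tangentBundle_source.2 hx)

variable [I.Boundaryless]

theorem tderiv_zeroSection_comp {E' : Type*} [NormedAddCommGroup E'] [NormedSpace ℝ E']
    {H' : Type*} [TopologicalSpace H'] {J : ModelWithCorners ℝ E' H'}
    {N : Type*} [TopologicalSpace N] [ChartedSpace H' N] {F : TangentBundle I Q → N} {x : Q}
    (hF : MDifferentiableAt I.tangent J F ⟨x, 0⟩) :
    tderiv I.tangent J F ⟨x, 0⟩ ∘L ContinuousLinearMap.inl ℝ E E =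
      tderiv I J (fun y => F ⟨y, 0⟩) x := by
  have hz := IsLinearInCharts.zeroSection (I := I) (M := Q)
  rw [← hz.tderiv_eq x, ← tderiv_comp_of_eq hF (hz.mdifferentiableAt x) rfl]
  rfl

theorem tderiv_fiber_comp {E' : Type*} [NormedAddCommGroup E'] [NormedSpace ℝ E']
    {H' : Type*} [TopologicalSpace H'] {J : ModelWithCorners ℝ E' H'}
    {N : Type*} [TopologicalSpace N] [ChartedSpace H' N] {F : TangentBundle I Q → N} {x : Q}
    (hF : MDifferentiableAt I.tangent J F ⟨x, 0⟩) :
    tderiv I.tangent J F ⟨x, 0⟩ ∘L ContinuousLinearMap.inr ℝ E E =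
      tderiv 𝓘(ℝ, E) J (fun v : E => F ⟨x, v⟩) 0 := by
  set ξ : TangentBundle I Q := ⟨x, 0⟩
  have hξ : extChartAt I.tangent ξ ξ = (extChartAt I x x, 0) := by
    rw [extChartAt_tangentBundle (mem_extChartAt_source (I := I) x)]
    exact Prod.ext rfl (map_zero (tderiv I 𝓘(ℝ, E) (extChartAt I x) x))
  have hchart : MDifferentiableAt 𝓘(ℝ, E × E) I.tangent (extChartAt I.tangent ξ).symm
      (extChartAt I x x, 0) :=
    hξ ▸ mdifferentiableAt_extChartAt_symm (mem_extChartAt_target ξ)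
  have hincl : HasFDerivAt (fun v : E => (extChartAt I x x, v)) (ContinuousLinearMap.inr ℝ E E) 0 :=
    hasFDerivAt_prodMk_right _ _
  have hsymm : tderiv 𝓘(ℝ, E × E) I.tangent (extChartAt I.tangent ξ).symm (extChartAt I x x, 0) =
      ContinuousLinearMap.id ℝ (E × E) := hξ ▸ tderiv_extChartAt_symm_self ξ
  have hfiber : (fun v : E => F ⟨x, v⟩) =
      F ∘ (extChartAt I.tangent ξ).symm ∘ fun v : E => (extChartAt I x x, v) :=
    funext fun v => congrArg F (extChartAt_symm_fiber x v).symm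
  rw [hfiber, tderiv_comp_of_eq hF (hchart.comp 0 hincl.differentiableAt.mdifferentiableAt)
    (extChartAt_symm_fiber x 0), tderiv_comp 0 hchart hincl.differentiableAt.mdifferentiableAt,
    tderiv_eq_fderiv, hincl.fderiv, hsymm]
  rfl

theorem tderiv_eq_fst_add_fiberDeriv_snd {F : TangentBundle I Q → Q} {x : Q}
    (hF : MDifferentiableAt I.tangent I F ⟨x, 0⟩) (hzero : ∀ y, F ⟨y, 0⟩ = y) :
    tderiv I.tangent I F ⟨x, 0⟩ =
      ContinuousLinearMap.fst ℝ E E + fiberDeriv I F x ∘L ContinuousLinearMap.snd ℝ E E := by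
  have hhor := tderiv_zeroSection_comp hF
  rw [show (fun y : Q => F ⟨y, 0⟩) = id from funext hzero, tderiv_id] at hhor
  refine ContinuousLinearMap.prod_ext ?_ ?_
  · rw [hhor, ContinuousLinearMap.add_comp, ContinuousLinearMap.comp_assoc,
      ContinuousLinearMap.fst_comp_inl, ContinuousLinearMap.snd_comp_inl,
      ContinuousLinearMap.comp_zero, add_zero]
  · rw [tderiv_fiber_comp hF, ContinuousLinearMap.add_comp, ContinuousLinearMap.comp_assoc,
      ContinuousLinearMap.fst_comp_inr, ContinuousLinearMap.snd_comp_inr,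
      ContinuousLinearMap.comp_id, zero_add]
    rfl

namespace IsDiscretizationMap

variable {U : Set (TangentBundle I Q)} {R : TangentBundle I Q → Q × Q}

theorem isLocalDiffeomorphAt_zero [CompleteSpace E] (hR : IsDiscretizationMap I U R) (x : Q) :
    IsLocalDiffeomorphAt I.tangent (I.prod I) ∞ R ⟨x, 0⟩ := by
  have hsmooth : ∀ᶠ ξ in 𝓝 (⟨x, 0⟩ : TangentBundle I Q),
      ContMDiffAt I.tangent (I.prod I) ∞ R ξ := by
    filter_upwards [hR.isOpen.mem_nhds (hR.zero_mem x)] with ξ hξ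
    exact hR.smooth.contMDiffAt (hR.isOpen.mem_nhds hξ)
  have hRx : MDifferentiableAt I.tangent (I.prod I) R ⟨x, 0⟩ :=
    hsmooth.self_of_nhds.mdifferentiableAt (by simp)
  have h₁ : MDifferentiableAt I.tangent I (fun ξ => (R ξ).1) ⟨x, 0⟩ :=
    mdifferentiableAt_fst.comp _ hRx
  have h₂ : MDifferentiableAt I.tangent I (fun ξ => (R ξ).2) ⟨x, 0⟩ :=
    mdifferentiableAt_snd.comp _ hRx
  have htderiv := tderiv_prodMk h₁ h₂
  rw [tderiv_eq_fst_add_fiberDeriv_snd h₁ fun y => congrArg Prod.fst (hR.map_zero y),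
    tderiv_eq_fst_add_fiberDeriv_snd h₂ fun y => congrArg Prod.snd (hR.map_zero y)] at htderiv
  exact isLocalDiffeomorphAt_of_isInvertible_tderiv hsmooth (by simp)
    (htderiv.symm ▸ isInvertible_of_sub_eq_id (hR.rigid x))

theorem exists_isDiffeoOn [CompleteSpace E]
    [TopologicalSpace.MetrizableSpace (TangentBundle I Q)]
    (hR : IsDiscretizationMap I U R) :
    ∃ V ⊆ U, (∀ x : Q, (⟨x, 0⟩ : TangentBundle I Q) ∈ V) ∧
      IsDiffeoOn I.tangent (I.prod I) R V (R '' V) := by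
  have : Nonempty (Q × Q → TangentBundle I Q) := ⟨fun q => ⟨q.1, 0⟩⟩
  obtain ⟨V, hV, hzero, hinj⟩ := exists_isOpen_injOn_of_section (p := Prod.fst)
    (IsLinearInCharts.zeroSection (I := I) (M := Q)).contMDiff.continuous
    (fun x => congrArg Prod.fst (hR.map_zero x))
    (fun x => continuous_fst.continuousAt.comp
      (hR.isLocalDiffeomorphAt_zero x).contMDiffAt.continuousAt)
    (fun x => exists_mem_nhds_injOn_of_isLocalDiffeomorphAt (hR.isLocalDiffeomorphAt_zero x))
  refine ⟨U ∩ V ∩ {ξ | IsLocalDiffeomorphAt I.tangent (I.prod I) ∞ R ξ}, fun ξ hξ => hξ.1.1,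
    fun x => ⟨⟨hR.zero_mem x, hzero x⟩, hR.isLocalDiffeomorphAt_zero x⟩, ?_⟩
  exact isDiffeoOn_image_of_injOn
    ((hR.isOpen.inter hV).inter (isOpen_setOf_isLocalDiffeomorphAt R))
    (fun ξ => ξ.2.2) (hinj.mono fun ξ hξ => hξ.1.2)

end IsDiscretizationMap

end Discretization

section Metrizability

theorem t2Space_totalSpace {B F : Type*} [TopologicalSpace B] [T2Space B] [TopologicalSpace F]
    [T2Space F] (Z : B → Type*) [TopologicalSpace (TotalSpace F Z)]
    [∀ b, TopologicalSpace (Z b)] [FiberBundle F Z] : T2Space (TotalSpace F Z) := by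
  refine ⟨fun ξ η hne => ?_⟩
  by_cases h : ξ.proj = η.proj
  · let e := trivializationAt F Z ξ.proj
    have hξ : ξ ∈ e.source := FiberBundle.mem_trivializationAt_proj_source
    have hη : η ∈ e.source := e.mem_source.2 (h ▸ mem_baseSet_trivializationAt F Z ξ.proj)
    obtain ⟨u, v, hu, hv, hξu, hηv, huv⟩ := t2_separation (e.injOn.ne hξ hη hne)
    exact ⟨_, _, e.continuousOn.isOpen_inter_preimage e.open_source hu,
      e.continuousOn.isOpen_inter_preimage e.open_source hv, ⟨hξ, hξu⟩, ⟨hη, hηv⟩,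
      (huv.preimage e).mono inter_subset_right inter_subset_right⟩
  · exact separated_by_continuous (FiberBundle.continuous_proj F Z) h

theorem secondCountableTopology_totalSpace {B F : Type*} [TopologicalSpace B]
    [SecondCountableTopology B] [TopologicalSpace F] [SecondCountableTopology F] (Z : B → Type*)
    [TopologicalSpace (TotalSpace F Z)] [∀ b, TopologicalSpace (Z b)] [FiberBundle F Z] :
    SecondCountableTopology (TotalSpace F Z) := by
  obtain ⟨s, hs, hcover⟩ := TopologicalSpace.countable_cover_nhds fun b : B =>
    (trivializationAt F Z b).open_baseSet.mem_nhds (mem_baseSet_trivializationAt F Z b)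
  have := hs.to_subtype
  have (b : s) : SecondCountableTopology (trivializationAt F Z (b : B)).source :=
    (trivializationAt F Z (b : B)).toOpenPartialHomeomorph.secondCountableTopology_source
  refine TopologicalSpace.secondCountableTopology_of_countable_cover
    (fun b : s => (trivializationAt F Z (b : B)).open_source)
    (iUnion_eq_univ_iff.2 fun ξ => ?_)
  obtain ⟨b, hb, hξ⟩ := mem_iUnion₂.1 (hcover.ge (mem_univ ξ.proj))
  exact ⟨⟨b, hb⟩, (trivializationAt F Z b).mem_source.2 hξ⟩

theorem metrizableSpace_tangentBundle {E : Type*} [NormedAddCommGroup E] [NormedSpace ℝ E]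
    [FiniteDimensional ℝ E] {H : Type*} [TopologicalSpace H] (I : ModelWithCorners ℝ E H)
    (M : Type*) [TopologicalSpace M] [ChartedSpace H M] [IsManifold I 1 M] [T2Space M]
    [SecondCountableTopology M] : TopologicalSpace.MetrizableSpace (TangentBundle I M) := by
  have := t2Space_totalSpace (F := E) (TangentSpace I : M → Type _)
  have := secondCountableTopology_totalSpace (F := E) (TangentSpace I : M → Type _)
  have := I.tangent.locallyCompactSpace
  have := ChartedSpace.locallyCompactSpace (ModelProd H E) (TangentBundle I M)
  exact Manifold.metrizableSpace I.tangent _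

end Metrizability

end

theorem mainTheorem1_general {E : Type*} [NormedAddCommGroup E] [NormedSpace ℝ E] [CompleteSpace E]
    {H : Type*} [TopologicalSpace H] (I : ModelWithCorners ℝ E H) [I.Boundaryless]
    {Q : Type*} [TopologicalSpace Q] [ChartedSpace H Q] [IsManifold I ∞ Q]
    [TopologicalSpace.MetrizableSpace (TangentBundle I Q)]
    (U : Set (TangentBundle I Q)) (R : TangentBundle I Q → Q × Q)
    (hR : IsDiscretizationMap I U R) :
    DiffForm.IsSymplectic I.cotangent.tangent (DiffForm.dT I.cotangent (canonicalForm I Q)) ∧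
    DiffForm.IsSymplectic (I.cotangent.prod I.cotangent) (omega12 I Q) ∧
    (∃ V ⊆ U, (∀ x : Q, (⟨x, 0⟩ : TangentBundle I Q) ∈ V) ∧
      IsDiffeoOn I.tangent (I.prod I) R V (R '' V)) ∧
    (∀ V ⊆ U, IsDiffeoOn I.tangent (I.prod I) R V (R '' V) →
      IsSymplectoOn I.cotangent.tangent (I.cotangent.prod I.cotangent)
        (DiffForm.dT I.cotangent (canonicalForm I Q)) (omega12 I Q) (cotangentLift I R)
        (tangentMap I.cotangent I (cotangentProj I (M := Q)) ⁻¹' V)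
        (Prod.map (cotangentProj I) (cotangentProj I) ⁻¹' (R '' V))) :=
  ⟨DiffForm.isSymplectic_dT_canonicalForm I Q, DiffForm.isSymplectic_omega12 I Q,
    hR.exists_isDiffeoOn, fun _ _ hV => isSymplectoOn_cotangentLift hV⟩

theorem mainTheorem1 {E : Type*} [NormedAddCommGroup E] [NormedSpace ℝ E] [FiniteDimensional ℝ E]
    {Q : Type*} [TopologicalSpace Q] [T2Space Q] [SecondCountableTopology Q]
    [ChartedSpace E Q] [IsManifold 𝓘(ℝ, E) ∞ Q]
    (U : Set (TangentBundle 𝓘(ℝ, E) Q)) (R : TangentBundle 𝓘(ℝ, E) Q → Q × Q)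
    (hR : IsDiscretizationMap 𝓘(ℝ, E) U R) :
    -- both manifolds are symplectic
    DiffForm.IsSymplectic 𝓘(ℝ, E).cotangent.tangent
      (DiffForm.dT 𝓘(ℝ, E).cotangent (canonicalForm 𝓘(ℝ, E) Q)) ∧
    DiffForm.IsSymplectic (𝓘(ℝ, E).cotangent.prod 𝓘(ℝ, E).cotangent) (omega12 𝓘(ℝ, E) Q) ∧
    -- `R` is a diffeomorphism from a neighbourhood of the zero section onto an open set
    (∃ V ⊆ U, (∀ x : Q, (⟨x, 0⟩ : TangentBundle 𝓘(ℝ, E) Q) ∈ V) ∧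
      IsDiffeoOn 𝓘(ℝ, E).tangent (𝓘(ℝ, E).prod 𝓘(ℝ, E)) R V (R '' V)) ∧
    -- wherever `R` is a diffeomorphism, its cotangent lift is a symplectomorphism
    (∀ V ⊆ U, IsDiffeoOn 𝓘(ℝ, E).tangent (𝓘(ℝ, E).prod 𝓘(ℝ, E)) R V (R '' V) →
      IsSymplectoOn 𝓘(ℝ, E).cotangent.tangent (𝓘(ℝ, E).cotangent.prod 𝓘(ℝ, E).cotangent)
        (DiffForm.dT 𝓘(ℝ, E).cotangent (canonicalForm 𝓘(ℝ, E) Q)) (omega12 𝓘(ℝ, E) Q)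
        (cotangentLift 𝓘(ℝ, E) R)
        (tangentMap 𝓘(ℝ, E).cotangent 𝓘(ℝ, E) (cotangentProj 𝓘(ℝ, E) (M := Q)) ⁻¹' V)
        (Prod.map (cotangentProj 𝓘(ℝ, E)) (cotangentProj 𝓘(ℝ, E)) ⁻¹' (R '' V))) := by
  have := FiniteDimensional.complete ℝ E
  have := metrizableSpace_tangentBundle 𝓘(ℝ, E) Q
  exact mainTheorem1_general 𝓘(ℝ, E) U R hR
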